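/- Let $M$ be a complex manifold with a Kähler form $\omega$ (definiteness of the metric is not needed: $\omega$ may be any closed nondegenerate real $(1,1)$-form). In holomorphic coordinates $z^k$ write $\omega=-i\,g_{k\bar l}\,dz^k\wedge d\bar z^l$, let $(g^{\bar lk})$ be the inverse matrix of $(g_{k\bar l})$, $\partial_k=\partial/\partial z^k$, $\bar\partial_l=\partial/\partial\bar z^l$, and sum over repeated indices. A star-product on $M$ is an associative, $\nu$-linear and $\nu$-adically continuous product $f\ast h=\sum_{r\ge0}\nu^rC_r(f,h)$ on $C^\infty(M)[[\nu]]$ with bidifferential operators $C_r$ (which therefore restricts to open subsets), with unit $1$, $C_0(f,h)=fh$ and $C_1(f,h)-C_1(h,f)=i\{f,h\}$, where $\{f,h\}=i\,g^{\bar lk}(\partial_kf\,\bar\partial_lh-\bar\partial_lf\,\partial_kh)$. It has separation of variables if on every open set $a\ast f=af$ and $f\ast b=bf$ for $a$ holomorphic, $b$ antiholomorphic and $f$ smooth. The standard star-product with separation of variables is the one such that on every contractible holomorphic chart $U$ and for every Kähler potential $\Phi$ on $U$ (a smooth real function with $g_{k\bar l}=\partial_k\bar\partial_l\Phi$) one has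 $\partial_k\Phi\ast f=\partial_k\Phi\, f+\nu\,\partial_kf$ and $f\ast\bar\partial_l\Phi=\bar\partial_l\Phi\, f+\nu\,\bar\partial_lf$ for all $f\in C^\infty(U)$. Let $\ast$ be the standard star-product with separation of variables, and let $(U,\{z^k\})$ be a holomorphic chart on which $\omega$ has a Kähler potential. Let $\Gamma_{kp}^s=(\partial_kg_{p\bar t})g^{\bar ts}$ and $\Gamma_{\bar l\bar q}^{\bar t}=g^{\bar ts}\,\bar\partial_lg_{s\bar q}$ be the Christoffel symbols of the Kähler connection $\nabla$; let $f_{/k}=\partial_kf$, $f_{/kp}$, $f_{/kps}$ and $f_{/\bar l}=\bar\partial_lf$, $f_{/\bar l\bar q}$, $f_{/\bar l\bar q\bar t}$ be the iterated covariant derivatives of a function $f$; let $R^p_{mk\bar l}=-\bar\partial_l\Gamma^p_{km}$ be the curvature of $\nabla$ and $R^{\bar lk\bar qp}=g^{\bar la}g^{\bar bk}g^{\bar qm}R^p_{ma\bar b}$. Then for all $\phi,\psi$ smooth on an open subset of $U$ one has there $$C_1(\phi,\psi)=g^{\bar lk}\phi_{/\bar l}\,\psi_{/k},$$ $$C_2(\phi,\psi)=\tfrac12\bigl(g^{\bar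 qp}g^{\bar lk}(\bar\partial_l\bar\partial_q\phi)(\partial_k\partial_p\psi)+g^{\bar qp}(\partial_pg^{\bar lk})(\bar\partial_l\bar\partial_q\phi)(\partial_k\psi)+(\bar\partial_lg^{\bar qp})g^{\bar lk}(\bar\partial_q\phi)(\partial_k\partial_p\psi)+(\bar\partial_lg^{\bar qp})(\partial_pg^{\bar lk})(\bar\partial_q\phi)(\partial_k\psi)\bigr)=\tfrac12g^{\bar lk}g^{\bar qp}\phi_{/\bar l\bar q}\,\psi_{/kp},$$ $$C_3(\phi,\psi)=\tfrac16g^{\bar lk}g^{\bar qp}g^{\bar ts}\phi_{/\bar l\bar q\bar t}\,\psi_{/kps}+\tfrac14R^{\bar lk\bar qp}\phi_{/\bar l\bar q}\,\psi_{/kp}.$$ -/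

import Mathlib

open scoped Manifold ContDiff Topology

noncomputable section

namespace KahlerStar

/-! ## Smooth and holomorphic functions, Wirtinger derivatives in holomorphic charts -/

section Charts

variable {n : ℕ} {M : Type*} [TopologicalSpace M] [ChartedSpace (Fin n → ℂ) M]

/-- `f` is a (real-)smooth complex-valued function on `U`. -/
def SmoothOn (n : ℕ) {M : Type*} [TopologicalSpace M] [ChartedSpace (Fin n → ℂ) M]
    (f : M → ℂ) (U : Set M) : Prop :=
  ContMDiffOn 𝓘(ℝ, Fin n → ℂ) 𝓘(ℝ, ℂ) ∞ f U

/-- `f` is holomorphic on `U`. -/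
def HolomorphicOn (n : ℕ) {M : Type*} [TopologicalSpace M] [ChartedSpace (Fin n → ℂ) M]
    (f : M → ℂ) (U : Set M) : Prop :=
  MDifferentiableOn 𝓘(ℂ, Fin n → ℂ) 𝓘(ℂ, ℂ) f U

/-- `f` is antiholomorphic on `U`, i.e. its complex conjugate is holomorphic. -/
def AntiholomorphicOn (n : ℕ) {M : Type*} [TopologicalSpace M] [ChartedSpace (Fin n → ℂ) M]
    (f : M → ℂ) (U : Set M) : Prop :=
  HolomorphicOn n (fun x => starRingEnd ℂ (f x)) U

/-- Holomorphic coordinate charts of the complex manifold `M`. The coordinates of the chart `e`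
on its domain `e.source` are `z^k = (e ·) k`. -/
def IsHolChart (e : OpenPartialHomeomorph M (Fin n → ℂ)) : Prop :=
  e ∈ IsManifold.maximalAtlas 𝓘(ℂ, Fin n → ℂ) ω M

/-- The Wirtinger derivative `∂_k = ∂/∂z^k = ½ (∂/∂x^k - i ∂/∂y^k)` in the chart `e`
(meaningful on `e.source`). -/
def del (e : OpenPartialHomeomorph M (Fin n → ℂ)) (k : Fin n) (f : M → ℂ) : M → ℂ := fun x =>
  (fderiv ℝ (f ∘ e.symm) (e x) (Pi.single k 1)
    - Complex.I * fderiv ℝ (f ∘ e.symm) (e x) (Pi.single k Complex.I)) / 2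

/-- The Wirtinger derivative `∂̄_l = ∂/∂z̄^l = ½ (∂/∂x^l + i ∂/∂y^l)` in the chart `e`
(meaningful on `e.source`). -/
def delBar (e : OpenPartialHomeomorph M (Fin n → ℂ)) (l : Fin n) (f : M → ℂ) : M → ℂ := fun x =>
  (fderiv ℝ (f ∘ e.symm) (e x) (Pi.single l 1)
    + Complex.I * fderiv ℝ (f ∘ e.symm) (e x) (Pi.single l Complex.I)) / 2

/-- Iterated coordinate derivatives along a word of holomorphic (`inl k`) and antiholomorphic
(`inr l`) indices. -/
def iterDel (e : OpenPartialHomeomorph M (Fin n → ℂ)) :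
    List (Fin n ⊕ Fin n) → (M → ℂ) → (M → ℂ)
  | [], f => f
  | Sum.inl k :: w, f => del e k (iterDel e w f)
  | Sum.inr l :: w, f => delBar e l (iterDel e w f)

/-- Bidifferential operators on `M`, together with their restrictions to all open subsets:
in every holomorphic chart, near every point, `B` is a finite sum
`B(f,g) = ∑ c_{v,w} (∂^v f) (∂^w g)` with smooth coefficients, for all functions `f`, `g` which are
smooth on some open set `W`, at the points of `W`. The values of `B f g` at points near which
`f` or `g` is not smooth carry no meaning. -/
def IsBidifferential (B : (M → ℂ) → (M → ℂ) → (M → ℂ)) : Prop :=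
  ∀ e : OpenPartialHomeomorph M (Fin n → ℂ), IsHolChart e → ∀ x ∈ e.source,
    ∃ V : Set M, IsOpen V ∧ x ∈ V ∧ V ⊆ e.source ∧
    ∃ (S : Finset (List (Fin n ⊕ Fin n) × List (Fin n ⊕ Fin n)))
      (c : List (Fin n ⊕ Fin n) × List (Fin n ⊕ Fin n) → M → ℂ),
      (∀ p ∈ S, SmoothOn n (c p) V) ∧
      ∀ (W : Set M) (f g : M → ℂ), IsOpen W → W ⊆ V → SmoothOn n f W → SmoothOn n g W →
        ∀ y ∈ W, B f g y = ∑ p ∈ S, c p y * iterDel e p.1 f y * iterDel e p.2 g y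

end Charts

/-! ## Kähler and pseudo-Kähler forms -/

section Kahler

variable {n : ℕ} {M : Type*} [TopologicalSpace M] [ChartedSpace (Fin n → ℂ) M]

/-- The coordinate expression at `z ∈ e.target` of a field `F` of real bilinear forms on the
tangent spaces, i.e. its pullback by `e.symm`. -/
def pullForm (F : ∀ x : M, LinearMap.BilinForm ℝ (TangentSpace 𝓘(ℂ, Fin n → ℂ) x))
    (e : OpenPartialHomeomorph M (Fin n → ℂ)) (z v w : Fin n → ℂ) : ℝ :=
  F (e.symm z)
    (mfderiv 𝓘(ℂ, Fin n → ℂ) 𝓘(ℂ, Fin n → ℂ) e.symm z v)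
    (mfderiv 𝓘(ℂ, Fin n → ℂ) 𝓘(ℂ, Fin n → ℂ) e.symm z w)

/-- The components `g_{k l̄} = i F(∂_k, ∂̄_l)` in the chart `e`, so that a real form `F` of
type (1,1) is `-i g_{k l̄} dz^k ∧ dz̄^l`. Here `F` is extended complex-bilinearly to
`∂_k = ½ (∂/∂x^k - i ∂/∂y^k)` and `∂̄_l = ½ (∂/∂x^l + i ∂/∂y^l)`. -/
def formCoeff (F : ∀ x : M, LinearMap.BilinForm ℝ (TangentSpace 𝓘(ℂ, Fin n → ℂ) x))
    (e : OpenPartialHomeomorph M (Fin n → ℂ)) (k l : Fin n) : M → ℂ := fun x =>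
  Complex.I * (1 / 4) *
    ((pullForm F e (e x) (Pi.single k 1) (Pi.single l 1) : ℂ)
      + (pullForm F e (e x) (Pi.single k Complex.I) (Pi.single l Complex.I) : ℂ)
      + Complex.I * ((pullForm F e (e x) (Pi.single k 1) (Pi.single l Complex.I) : ℂ)
        - (pullForm F e (e x) (Pi.single k Complex.I) (Pi.single l 1) : ℂ)))

/-- A pseudo-Kähler form on the complex manifold `M`: a smooth closed
nondegenerate real 2-form of type (1,1). Kähler forms are those for which `g_{k l̄}` is definite
(of either sign, depending on the convention). -/
structure PseudoKahlerForm (n : ℕ) (M : Type*) [TopologicalSpace M] [ChartedSpace (Fin n → ℂ) M] where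
  form : ∀ x : M, LinearMap.BilinForm ℝ (TangentSpace 𝓘(ℂ, Fin n → ℂ) x)
  alternating : ∀ x v, form x v v = 0
  type_one_one : ∀ x v w, form x (Complex.I • v) (Complex.I • w) = form x v w
  nondegenerate : ∀ x v, (∀ w, form x v w = 0) → v = 0
  smooth : ∀ e : OpenPartialHomeomorph M (Fin n → ℂ), IsHolChart e →
    ∀ k l, SmoothOn n (formCoeff form e k l) e.source
  closed : ∀ e : OpenPartialHomeomorph M (Fin n → ℂ), IsHolChart e → ∀ x ∈ e.source, ∀ k p l,
    del e p (formCoeff form e k l) x = del e k (formCoeff form e p l) x ∧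
    delBar e p (formCoeff form e l k) x = delBar e k (formCoeff form e l p) x

namespace PseudoKahlerForm

variable (Ω : PseudoKahlerForm n M) (e : OpenPartialHomeomorph M (Fin n → ℂ))

/-- The metric tensor `g_{k l̄}` in the chart `e`. -/
def g (k l : Fin n) : M → ℂ := formCoeff Ω.form e k l

/-- The inverse metric tensor `g^{l̄ k}` in the chart `e`; the first argument is the
antiholomorphic index. -/
def gInv (l k : Fin n) : M → ℂ := fun x => (Matrix.of fun a b => Ω.g e a b x)⁻¹ l k

/-- `Φ` is a Kähler potential of the form on the domain of the chart `e`. -/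
def IsPotential (Φ : M → ℝ) : Prop :=
  SmoothOn n (fun x => (Φ x : ℂ)) e.source ∧
  ∀ x ∈ e.source, ∀ k l, Ω.g e k l x = del e k (delBar e l fun y => (Φ y : ℂ)) x

/-- The Poisson bracket of the bivector field `η = i g^{l̄ k} ∂_k ∧ ∂̄_l`. -/
def bracket (f h : M → ℂ) : M → ℂ := fun x =>
  Complex.I * ∑ l, ∑ k, Ω.gInv e l k x *
    (del e k f x * delBar e l h x - delBar e l f x * del e k h x)

/-- The Christoffel symbol `Γ_{kp}^s = (∂_k g_{p t̄}) g^{t̄ s}` of the Kähler connection. -/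
def christoffel (k p s : Fin n) : M → ℂ := fun x =>
  ∑ t, del e k (Ω.g e p t) x * Ω.gInv e t s x

/-- The Christoffel symbol `Γ_{l̄ q̄}^{t̄} = g^{t̄ s} (∂̄_l g_{s q̄})` of the Kähler connection. -/
def christoffelBar (l q t : Fin n) : M → ℂ := fun x =>
  ∑ s, Ω.gInv e t s x * delBar e l (Ω.g e s q) x

/-- The covariant derivatives `f_{/kp}`. -/
def cov2 (f : M → ℂ) (k p : Fin n) : M → ℂ := fun x =>
  del e p (del e k f) x - ∑ m, Ω.christoffel e p k m x * del e m f x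

/-- The covariant derivatives `f_{/kps}`. -/
def cov3 (f : M → ℂ) (k p s : Fin n) : M → ℂ := fun x =>
  del e s (Ω.cov2 e f k p) x
    - ∑ m, Ω.christoffel e s k m x * Ω.cov2 e f m p x
    - ∑ m, Ω.christoffel e s p m x * Ω.cov2 e f k m x

/-- The covariant derivatives `f_{/l̄ q̄}`. -/
def covBar2 (f : M → ℂ) (l q : Fin n) : M → ℂ := fun x =>
  delBar e q (delBar e l f) x - ∑ m, Ω.christoffelBar e q l m x * delBar e m f x

/-- The covariant derivatives `f_{/l̄ q̄ t̄}`. -/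
def covBar3 (f : M → ℂ) (l q t : Fin n) : M → ℂ := fun x =>
  delBar e t (Ω.covBar2 e f l q) x
    - ∑ m, Ω.christoffelBar e t l m x * Ω.covBar2 e f m q x
    - ∑ m, Ω.christoffelBar e t q m x * Ω.covBar2 e f l m x

/-- The curvature `R^p_{m k l̄}` of the Kähler connection, the coefficient of `∂_p` in
`R(∂_k, ∂̄_l) ∂_m = ∇_k ∇_{l̄} ∂_m - ∇_{l̄} ∇_k ∂_m = -(∂̄_l Γ_{km}^p) ∂_p`. -/
def curvature (p m k l : Fin n) : M → ℂ := fun x => -delBar e l (Ω.christoffel e k m p) x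

/-- The curvature with two raised indices, `R_{k l̄}^{q̄ p} = g^{q̄ m} R^p_{m k l̄}`. -/
def curvatureMixed (k l q p : Fin n) : M → ℂ := fun x =>
  ∑ m, Ω.gInv e q m x * Ω.curvature e p m k l x

/-- The curvature with all indices raised, `R^{l̄ k q̄ p} = g^{l̄ a} g^{b̄ k} R_{a b̄}^{q̄ p}`. -/
def curvatureUp (l k q p : Fin n) : M → ℂ := fun x =>
  ∑ a, ∑ b, Ω.gInv e l a x * Ω.gInv e b k x * Ω.curvatureMixed e a b q p x

end PseudoKahlerForm

end Kahler

/-! ## Star-products -/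

section Star

variable {n : ℕ} {M : Type*} [TopologicalSpace M] [ChartedSpace (Fin n → ℂ) M]

/-- The `ν`-linear, `ν`-adically continuous product on formal series with
`f * h = ∑_r ν^r C_r(f,h)` for functions `f`, `h`. -/
def star (C : ℕ → (M → ℂ) → (M → ℂ) → (M → ℂ)) (F G : PowerSeries (M → ℂ)) :
    PowerSeries (M → ℂ) :=
  PowerSeries.mk fun N => ∑ a ∈ Finset.HasAntidiagonal.antidiagonal N,
    ∑ b ∈ Finset.HasAntidiagonal.antidiagonal a.2,
    C a.1 (PowerSeries.coeff b.1 F) (PowerSeries.coeff b.2 G)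

/-- Formal series with coefficients in `C^∞(U)`. -/
def SmoothSeriesOn (n : ℕ) {M : Type*} [TopologicalSpace M] [ChartedSpace (Fin n → ℂ) M]
    (F : PowerSeries (M → ℂ)) (U : Set M) : Prop :=
  ∀ r, SmoothOn n (PowerSeries.coeff r F) U

/-- Equality on `U` of formal series of functions. -/
def SeriesEqOn (F G : PowerSeries (M → ℂ)) (U : Set M) : Prop :=
  ∀ r, Set.EqOn (PowerSeries.coeff r F) (PowerSeries.coeff r G) U

/-- `C` defines a differentiable deformation quantization (star-product) on `M` with the Poisson
structure inverse to `Ω`, localized to all open subsets `U` of `M`. -/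
structure IsStarProduct (Ω : PseudoKahlerForm n M) (C : ℕ → (M → ℂ) → (M → ℂ) → (M → ℂ)) : Prop where
  bidifferential : ∀ r, IsBidifferential (n := n) (C r)
  assoc : ∀ (U : Set M) (F G H : PowerSeries (M → ℂ)), IsOpen U →
    SmoothSeriesOn n F U → SmoothSeriesOn n G U → SmoothSeriesOn n H U →
    SeriesEqOn (star C (star C F G) H) (star C F (star C G H)) U
  one_left : ∀ (U : Set M) (F : PowerSeries (M → ℂ)), IsOpen U → SmoothSeriesOn n F U →
    SeriesEqOn (star C 1 F) F U
  one_right : ∀ (U : Set M) (F : PowerSeries (M → ℂ)), IsOpen U → SmoothSeriesOn n F U →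
    SeriesEqOn (star C F 1) F U
  zeroth : ∀ (U : Set M) (f h : M → ℂ), IsOpen U → SmoothOn n f U → SmoothOn n h U →
    Set.EqOn (C 0 f h) (f * h) U
  first : ∀ e : OpenPartialHomeomorph M (Fin n → ℂ), IsHolChart e →
    ∀ (U : Set M) (f h : M → ℂ), IsOpen U → U ⊆ e.source → SmoothOn n f U → SmoothOn n h U →
    Set.EqOn (C 1 f h - C 1 h f) (fun x => Complex.I * Ω.bracket e f h x) U

/-- Star-products with separation of variables: `a * f = a f` for `a` holomorphic and
`f * b = b f` for `b` antiholomorphic, on every open subset. -/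
structure IsSeparationOfVariables (Ω : PseudoKahlerForm n M)
    (C : ℕ → (M → ℂ) → (M → ℂ) → (M → ℂ)) : Prop extends IsStarProduct Ω C where
  left_holomorphic : ∀ (U : Set M) (a f : M → ℂ), IsOpen U → HolomorphicOn n a U →
    SmoothOn n f U → SeriesEqOn (star C (PowerSeries.C a) (PowerSeries.C f))
      (PowerSeries.C (a * f)) U
  right_antiholomorphic : ∀ (U : Set M) (b f : M → ℂ), IsOpen U → AntiholomorphicOn n b U →
    SmoothOn n f U → SeriesEqOn (star C (PowerSeries.C f) (PowerSeries.C b))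
      (PowerSeries.C (b * f)) U

/-- The standard star-product with separation of variables: on every contractible holomorphic
chart and for every Kähler potential `Φ` on it, `L_{∂_k Φ} = ∂_k Φ + ν ∂_k` and
`R_{∂̄_l Φ} = ∂̄_l Φ + ν ∂̄_l`. -/
structure IsStandard (Ω : PseudoKahlerForm n M)
    (C : ℕ → (M → ℂ) → (M → ℂ) → (M → ℂ)) : Prop extends IsSeparationOfVariables Ω C where
  left_potential : ∀ e : OpenPartialHomeomorph M (Fin n → ℂ), IsHolChart e →
    ContractibleSpace e.source → ∀ Φ : M → ℝ, Ω.IsPotential e Φ →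
    ∀ (k : Fin n) (f : M → ℂ), SmoothOn n f e.source →
      SeriesEqOn
        (star C (PowerSeries.C (del e k fun x => (Φ x : ℂ))) (PowerSeries.C f))
        (PowerSeries.C ((del e k fun x => (Φ x : ℂ)) * f)
          + PowerSeries.X * PowerSeries.C (del e k f)) e.source
  right_potential : ∀ e : OpenPartialHomeomorph M (Fin n → ℂ), IsHolChart e →
    ContractibleSpace e.source → ∀ Φ : M → ℝ, Ω.IsPotential e Φ →
    ∀ (l : Fin n) (f : M → ℂ), SmoothOn n f e.source →
      SeriesEqOn
        (star C (PowerSeries.C f) (PowerSeries.C (delBar e l fun x => (Φ x : ℂ))))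
        (PowerSeries.C ((delBar e l fun x => (Φ x : ℂ)) * f)
          + PowerSeries.X * PowerSeries.C (delBar e l f)) e.source

end Star

end KahlerStar

end

/-!
On the algebra of smooth functions left multiplication by a holomorphic function `a` is `a`, and by
`∂_k Φ` it is `∂_k Φ + ν ∂_k`, so associativity determines `C_{r+1}(a f, h)` from `C_{r+1}(f, h)`
and `C_r` for these `a`. By Hadamard's lemma, applied on a ball so small that the averages of the
metric over segments stay invertible, the functions `a - a(y)` generate the ideal of functions
vanishing at `y`; hence the recursion has at most one solution, and it suffices to check that the
claimed expressions satisfy it.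

For that check, the vector fields `D^{l̄} = g^{l̄ k} ∂_k` commute, since `[D^{l̄}, D^{q̄}]` is a
combination of the `∂_k` annihilating every `∂̄_s Φ`. Raising indices turns covariant derivatives
into iterates of the `D^{l̄}`, and `Γ_{b̄ t̄}^{q̄} = D^{q̄} ∂̄_b ∂̄_t Φ`, so that
`C_2 = ½ f_{/l̄ q̄} D^{l̄} D^{q̄} h`, and similarly for `C_3`.
-/

namespace KahlerStar

section KahlerAlgebras

open scoped Matrix

variable {𝕜 ι R : Type*} [CommRing 𝕜] [CommRing R] [Algebra 𝕜 R]

lemma map_derivation_one [DecidableEq ι] (δ : Derivation 𝕜 R R) :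
    (1 : Matrix ι ι R).map δ = 0 := by
  ext i j
  simp [Matrix.one_apply, apply_ite δ]

variable [Fintype ι]

lemma map_derivation_mul (δ : Derivation 𝕜 R R) (A B : Matrix ι ι R) :
    (A * B).map δ = A.map δ * B + A * B.map δ := by
  ext i j
  simp only [Matrix.map_apply, Matrix.mul_apply, Matrix.add_apply, map_sum, Derivation.leibniz,
    smul_eq_mul, Finset.sum_add_distrib, mul_comm (B _ j)]
  exact add_comm _ _

variable [DecidableEq ι]

lemma map_derivation_of_mul_eq_one (δ : Derivation 𝕜 R R) {A B : Matrix ι ι R} (h : A * B = 1) :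
    A.map δ = -(A * B.map δ * A) := by
  have hδ : A.map δ * B + A * B.map δ = 0 := by
    rw [← map_derivation_mul, h, map_derivation_one]
  calc A.map δ = A.map δ * B * A := by rw [mul_assoc, mul_eq_one_comm.mp h, mul_one]
    _ = -(A * B.map δ * A) := by rw [eq_neg_of_add_eq_zero_left hδ, neg_mul]

variable (𝕜 ι R) in
/-- The algebraic data of a Kähler potential: commuting derivations `d k = ∂_k` and
`dBar l = ∂̄_l` of a commutative algebra, and an element `pot = Φ` whose matrix of mixed second
derivatives `g_{k l̄} = ∂_k ∂̄_l Φ` has the inverse `gInv = (g^{l̄ k})`. -/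
structure KahlerAlgebra where
  d : ι → Derivation 𝕜 R R
  dBar : ι → Derivation 𝕜 R R
  pot : R
  gInv : Matrix ι ι R
  d_comm : ∀ k p f, d k (d p f) = d p (d k f)
  dBar_comm : ∀ l q f, dBar l (dBar q f) = dBar q (dBar l f)
  d_dBar : ∀ k l f, d k (dBar l f) = dBar l (d k f)
  gInv_mul : gInv * Matrix.of (fun k l => d k (dBar l pot)) = 1

namespace KahlerAlgebra

variable (K : KahlerAlgebra 𝕜 ι R)

/-- The metric `g_{k l̄}`. -/
def g : Matrix ι ι R := Matrix.of fun k l => K.d k (K.dBar l K.pot)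

/-- The Christoffel symbol `Γ_{kp}^s`. -/
def christoffel (k p s : ι) : R := ∑ t, K.d k (K.g p t) * K.gInv t s

/-- The Christoffel symbol `Γ_{l̄ q̄}^{t̄}`. -/
def christoffelBar (l q t : ι) : R := ∑ s, K.gInv t s * K.dBar l (K.g s q)

/-- The covariant derivative `f_{/kp}`. -/
def cov2 (f : R) (k p : ι) : R := K.d p (K.d k f) - ∑ m, K.christoffel p k m * K.d m f

/-- The covariant derivative `f_{/kps}`. -/
def cov3 (f : R) (k p s : ι) : R :=
  K.d s (K.cov2 f k p) - ∑ m, K.christoffel s k m * K.cov2 f m p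
    - ∑ m, K.christoffel s p m * K.cov2 f k m

/-- The covariant derivative `f_{/l̄ q̄}`. -/
def covBar2 (f : R) (l q : ι) : R :=
  K.dBar q (K.dBar l f) - ∑ m, K.christoffelBar q l m * K.dBar m f

/-- The covariant derivative `f_{/l̄ q̄ t̄}`. -/
def covBar3 (f : R) (l q t : ι) : R :=
  K.dBar t (K.covBar2 f l q) - ∑ m, K.christoffelBar t l m * K.covBar2 f m q
    - ∑ m, K.christoffelBar t q m * K.covBar2 f l m

/-- The curvature `R^{l̄ k q̄ p}` with all indices raised. -/
def curvatureUp (l k q p : ι) : R :=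
  ∑ a, ∑ b, K.gInv l a * K.gInv b k * ∑ m, K.gInv q m * -K.dBar b (K.christoffel a m p)

/-- The derivation `D^{l̄} = g^{l̄ k} ∂_k`. Where `∂̄_1 Φ, …, ∂̄_n Φ, z̄^1, …, z̄^n` are
coordinates, it is the partial derivative with respect to `∂̄_l Φ`. -/
def grad (l : ι) : Derivation 𝕜 R R := ∑ k, K.gInv l k • K.d k

lemma grad_apply (l : ι) (f : R) : K.grad l f = ∑ k, K.gInv l k * K.d k f := by
  rw [grad, ← Derivation.coeFnAddMonoidHom_apply, map_sum, Finset.sum_apply]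
  rfl

lemma gInv_mul_g : K.gInv * K.g = 1 := K.gInv_mul

lemma g_mul_gInv : K.g * K.gInv = 1 := mul_eq_one_comm.mp K.gInv_mul

lemma sum_g_mul_grad (k : ι) (f : R) : ∑ l, K.g k l * K.grad l f = K.d k f := by
  calc ∑ l, K.g k l * K.grad l f = (K.g *ᵥ K.gInv *ᵥ fun p => K.d p f) k := by
        simp only [grad_apply]
        rfl
    _ = K.d k f := by rw [Matrix.mulVec_mulVec, K.g_mul_gInv, Matrix.one_mulVec]

lemma grad_dBar_pot (l q : ι) : K.grad l (K.dBar q K.pot) = (1 : Matrix ι ι R) l q := by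
  rw [← K.gInv_mul_g, grad_apply]
  rfl

lemma eq_zero_of_sum_mul_g_eq_zero {c : ι → R} (hc : ∀ q, ∑ k, c k * K.g k q = 0) : c = 0 := by
  have hcg : c ᵥ* K.g = 0 := funext hc
  simpa [K.g_mul_gInv] using congrArg (· ᵥ* K.gInv) hcg

/-- The commutator is a combination of the `∂_k` which kills every `∂̄_s Φ`. -/
lemma grad_comm (l q : ι) (f : R) : K.grad l (K.grad q f) = K.grad q (K.grad l f) := by
  let c : ι → R := fun k => K.grad l (K.gInv q k) - K.grad q (K.gInv l k)
  have hbracket : ∀ f, K.grad l (K.grad q f) - K.grad q (K.grad l f) = ∑ k, c k * K.d k f := by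
    intro f
    have hsymm : ∑ k, K.gInv q k * K.grad l (K.d k f) = ∑ k, K.gInv l k * K.grad q (K.d k f) := by
      simp only [grad_apply, Finset.mul_sum]
      rw [Finset.sum_comm]
      simp only [mul_left_comm (K.gInv q _), K.d_comm]
    simp only [c, grad_apply K _ f, map_sum, Derivation.leibniz, smul_eq_mul, sub_mul,
      Finset.sum_add_distrib, Finset.sum_sub_distrib, hsymm, mul_comm (K.d _ f)]
    ring
  have hc : c = 0 := K.eq_zero_of_sum_mul_g_eq_zero fun s => by
    refine (hbracket (K.dBar s K.pot)).symm.trans ?_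
    simp [grad_dBar_pot, Matrix.one_apply, apply_ite (K.grad _)]
  rw [← sub_eq_zero, hbracket, hc]
  simp

lemma christoffelBar_eq_grad (b t q : ι) :
    K.christoffelBar b t q = K.grad q (K.dBar b (K.dBar t K.pot)) := by
  simp only [grad_apply, K.d_dBar]
  simp only [christoffelBar, g, Matrix.of_apply, K.d_dBar]

lemma covBar2_symm (f : R) (l q : ι) : K.covBar2 f l q = K.covBar2 f q l := by
  simp only [covBar2, christoffelBar_eq_grad, K.dBar_comm q l]

lemma christoffel_mul_g (k p t : ι) : ∑ s, K.christoffel k p s * K.g s t = K.d k (K.g p t) := by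
  have h : (K.g.map (K.d k) * K.gInv) * K.g = K.g.map (K.d k) := by
    rw [mul_assoc, K.gInv_mul_g, mul_one]
  exact congrFun₂ h p t

lemma g_mul_christoffelBar (l q k : ι) :
    ∑ t, K.g k t * K.christoffelBar l q t = K.dBar l (K.g k q) := by
  have h : K.g * (K.gInv * K.g.map (K.dBar l)) = K.g.map (K.dBar l) := by
    rw [← mul_assoc, K.g_mul_gInv, one_mul]
  exact congrFun₂ h k q

lemma d_gInv (k l p : ι) : K.d k (K.gInv l p) = -∑ m, K.gInv l m * K.christoffel k m p := by
  have h := map_derivation_of_mul_eq_one (K.d k) K.gInv_mul_g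
  rw [mul_assoc] at h
  exact congrFun₂ h l p

lemma dBar_gInv (l q p : ι) :
    K.dBar l (K.gInv q p) = -∑ m, K.christoffelBar l m q * K.gInv m p :=
  congrFun₂ (map_derivation_of_mul_eq_one (K.dBar l) K.gInv_mul_g) q p

/-- The inverse metric is parallel. -/
lemma sum_gInv_mul_covariant (s l : ι) (X : ι → R) :
    ∑ k, K.gInv l k * (K.d s (X k) - ∑ m, K.christoffel s k m * X m)
      = K.d s (∑ k, K.gInv l k * X k) := by
  have hΓ : ∑ k, K.gInv l k * ∑ m, K.christoffel s k m * X m = -∑ m, X m * K.d s (K.gInv l m) := by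
    simp only [d_gInv, mul_neg, Finset.sum_neg_distrib, neg_neg, Finset.mul_sum]
    rw [Finset.sum_comm]
    exact Finset.sum_congr rfl fun _ _ => Finset.sum_congr rfl fun _ _ => by ring
  simp only [mul_sub, Finset.sum_sub_distrib, hΓ, map_sum, Derivation.leibniz, smul_eq_mul,
    Finset.sum_add_distrib, sub_neg_eq_add]

lemma sum_gInv_mul_covariantBar (l p : ι) (X : ι → R) :
    ∑ q, K.gInv q p * (K.dBar l (X q) - ∑ m, K.christoffelBar l q m * X m)
      = K.dBar l (∑ q, K.gInv q p * X q) := by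
  have hΓ : ∑ q, K.gInv q p * ∑ m, K.christoffelBar l q m * X m
      = -∑ m, X m * K.dBar l (K.gInv m p) := by
    simp only [dBar_gInv, mul_neg, Finset.sum_neg_distrib, neg_neg, Finset.mul_sum]
    rw [Finset.sum_comm]
    exact Finset.sum_congr rfl fun _ _ => Finset.sum_congr rfl fun _ _ => by ring
  simp only [mul_sub, Finset.sum_sub_distrib, hΓ, map_sum, Derivation.leibniz, smul_eq_mul,
    Finset.sum_add_distrib, sub_neg_eq_add]

lemma sum_gInv_mul_cov2 (h : R) (l p : ι) :
    ∑ k, K.gInv l k * K.cov2 h k p = K.d p (K.grad l h) := by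
  rw [grad_apply, ← sum_gInv_mul_covariant]
  rfl

lemma sum_gInv_mul_covBar2 (f : R) (l p : ι) :
    ∑ q, K.gInv q p * K.covBar2 f l q = K.dBar l (∑ q, K.gInv q p * K.dBar q f) := by
  simp only [K.covBar2_symm f l]
  exact K.sum_gInv_mul_covariantBar l p fun q => K.dBar q f

lemma sum_gInv_gInv_mul_cov2 (h : R) (l q : ι) :
    ∑ k, ∑ p, K.gInv l k * K.gInv q p * K.cov2 h k p = K.grad l (K.grad q h) := by
  rw [grad_comm, grad_apply, Finset.sum_comm]
  simp only [← sum_gInv_mul_cov2, Finset.mul_sum]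
  simp only [mul_assoc, mul_left_comm]

lemma sum_gInv_mul_cov3 (h : R) (l p s : ι) :
    ∑ k, K.gInv l k * K.cov3 h k p s
      = K.d s (K.d p (K.grad l h)) - ∑ m, K.christoffel s p m * K.d m (K.grad l h) := by
  have hΓ : ∑ k, K.gInv l k * ∑ m, K.christoffel s p m * K.cov2 h k m
      = ∑ m, K.christoffel s p m * K.d m (K.grad l h) := by
    simp only [← sum_gInv_mul_cov2, Finset.mul_sum]
    rw [Finset.sum_comm]
    simp only [mul_left_comm]
  simp only [cov3, mul_sub _ (_ - _), Finset.sum_sub_distrib, hΓ]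
  rw [K.sum_gInv_mul_covariant s l fun k => K.cov2 h k p, sum_gInv_mul_cov2]

lemma sum_gInv_gInv_gInv_mul_cov3 (h : R) (l q t : ι) :
    ∑ k, ∑ p, ∑ s, K.gInv l k * K.gInv q p * K.gInv t s * K.cov3 h k p s
      = K.grad l (K.grad q (K.grad t h)) := by
  have hraise : ∀ s, ∑ p, K.gInv q p * ∑ k, K.gInv l k * K.cov3 h k p s
      = K.d s (K.grad q (K.grad l h)) := fun s => by
    simp only [sum_gInv_mul_cov3]
    rw [K.sum_gInv_mul_covariant s q fun p => K.d p (K.grad l h), ← grad_apply]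
  calc _ = ∑ s, K.gInv t s * ∑ p, K.gInv q p * ∑ k, K.gInv l k * K.cov3 h k p s := by
        simp only [Finset.mul_sum]
        rw [Finset.sum_comm_cycle]
        refine Finset.sum_congr rfl fun s _ => ?_
        rw [Finset.sum_comm]
        simp only [mul_assoc, mul_left_comm]
    _ = K.grad t (K.grad q (K.grad l h)) := by simp only [hraise, ← grad_apply]
    _ = K.grad l (K.grad q (K.grad t h)) := by
        rw [K.grad_comm q l, K.grad_comm t l, K.grad_comm t q]

/-- Differentiating `Γ_a g = ∂_a g` by `∂̄_b` and `g Γ̄_b = ∂̄_b g` by `∂_a` gives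
`(∂̄_b Γ_a) g = g (∂_a Γ̄_b)`, since `Γ_a ∂̄_b g = Γ_a g Γ̄_b = (∂_a g) Γ̄_b`. -/
lemma sum_gInv_mul_dBar_christoffel (a b q p : ι) :
    ∑ m, K.gInv q m * K.dBar b (K.christoffel a m p)
      = ∑ t, K.d a (K.christoffelBar b t q) * K.gInv t p := by
  let Γ : Matrix ι ι R := Matrix.of (K.christoffel a)
  let ΓBar : Matrix ι ι R := Matrix.of fun q t => K.christoffelBar b t q
  have hΓ : Γ * K.g = K.g.map (K.d a) := Matrix.ext fun m t => K.christoffel_mul_g a m t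
  have hΓBar : K.g * ΓBar = K.g.map (K.dBar b) :=
    Matrix.ext fun m t => K.g_mul_christoffelBar b t m
  have hmixed : (K.g.map (K.d a)).map (K.dBar b) = (K.g.map (K.dBar b)).map (K.d a) :=
    Matrix.ext fun m t => (K.d_dBar a b _).symm
  rw [← hΓ, ← hΓBar, map_derivation_mul, map_derivation_mul, ← hΓ, ← hΓBar, mul_assoc, add_comm,
    add_right_inj] at hmixed
  have key : K.gInv * Γ.map (K.dBar b) = ΓBar.map (K.d a) * K.gInv := by
    calc K.gInv * Γ.map (K.dBar b) = K.gInv * (Γ.map (K.dBar b) * K.g) * K.gInv := by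
          rw [mul_assoc, mul_assoc, K.g_mul_gInv, mul_one]
      _ = ΓBar.map (K.d a) * K.gInv := by rw [hmixed, ← mul_assoc, K.gInv_mul_g, one_mul]
  exact congrFun₂ key q p

lemma curvatureUp_eq (l k q p : ι) : K.curvatureUp l k q p
    = -∑ b, ∑ t, K.grad l (K.christoffelBar b t q) * (K.gInv b k * K.gInv t p) := by
  simp only [curvatureUp, mul_neg, Finset.sum_neg_distrib, sum_gInv_mul_dBar_christoffel,
    grad_apply, Finset.mul_sum, Finset.sum_mul]
  rw [Finset.sum_comm]
  refine congrArg _ (Finset.sum_congr rfl fun b _ => ?_)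
  rw [Finset.sum_comm]
  exact Finset.sum_congr rfl fun t _ => Finset.sum_congr rfl fun a _ => by ring

lemma sum_curvatureUp_mul_cov2 (h : R) (l q : ι) :
    ∑ k, ∑ p, K.curvatureUp l k q p * K.cov2 h k p
      = -∑ b, ∑ t, K.grad l (K.grad q (K.dBar b (K.dBar t K.pot))) * K.grad b (K.grad t h) := by
  simp only [curvatureUp_eq, christoffelBar_eq_grad, ← sum_gInv_gInv_mul_cov2 K h, neg_mul,
    Finset.sum_neg_distrib, Finset.sum_mul, Finset.mul_sum]
  rw [Finset.sum_comm_cycle]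
  refine congrArg _ (Finset.sum_congr rfl fun b _ => ?_)
  rw [Finset.sum_comm_cycle]
  exact Finset.sum_congr rfl fun t _ => Finset.sum_congr rfl fun k _ =>
    Finset.sum_congr rfl fun p _ => by ring

/-- The contraction `g^{l̄ k} f_{/l̄} h_{/k}`. -/
def pairing1 (f h : R) : R := ∑ l, K.dBar l f * K.grad l h

/-- The contraction `g^{l̄ k} g^{q̄ p} f_{/l̄ q̄} h_{/kp}`. -/
def pairing2 (f h : R) : R := ∑ l, ∑ q, K.covBar2 f l q * K.grad l (K.grad q h)

/-- The contraction `g^{l̄ k} g^{q̄ p} g^{t̄ s} f_{/l̄ q̄ t̄} h_{/kps}`. -/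
def pairing3 (f h : R) : R :=
  ∑ l, ∑ q, ∑ t, K.covBar3 f l q t * K.grad l (K.grad q (K.grad t h))

/-- The contraction `R^{l̄ k q̄ p} f_{/l̄ q̄} h_{/kp}`. -/
def curvaturePairing (f h : R) : R :=
  ∑ l, ∑ q, K.covBar2 f l q *
    -∑ b, ∑ t, K.grad l (K.grad q (K.dBar b (K.dBar t K.pot))) * K.grad b (K.grad t h)

lemma pairing1_eq_sum (f h : R) :
    K.pairing1 f h = ∑ l, ∑ k, K.gInv l k * K.dBar l f * K.d k h := by
  simp only [pairing1, grad_apply, Finset.mul_sum, mul_left_comm (K.dBar _ f), mul_assoc]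

lemma pairing2_eq_sum (f h : R) : K.pairing2 f h =
    ∑ l, ∑ k, ∑ q, ∑ p, K.gInv l k * K.gInv q p * K.covBar2 f l q * K.cov2 h k p := by
  simp only [pairing2, ← sum_gInv_gInv_mul_cov2, Finset.mul_sum]
  refine Finset.sum_congr rfl fun l _ => ?_
  rw [Finset.sum_comm]
  simp only [mul_left_comm (K.covBar2 f l _), mul_assoc]

lemma pairing3_eq_sum (f h : R) : K.pairing3 f h =
    ∑ l, ∑ k, ∑ q, ∑ p, ∑ t, ∑ s,
      K.gInv l k * K.gInv q p * K.gInv t s * K.covBar3 f l q t * K.cov3 h k p s := by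
  simp only [pairing3, ← sum_gInv_gInv_gInv_mul_cov3, Finset.mul_sum]
  refine Finset.sum_congr rfl fun l _ => ?_
  rw [Finset.sum_comm_cycle]
  refine Finset.sum_congr rfl fun k _ => Finset.sum_congr rfl fun q _ => ?_
  rw [Finset.sum_comm]
  simp only [mul_left_comm (K.covBar3 f l q _), mul_assoc]

lemma curvaturePairing_eq_sum (f h : R) : K.curvaturePairing f h =
    ∑ l, ∑ k, ∑ q, ∑ p, K.curvatureUp l k q p * K.covBar2 f l q * K.cov2 h k p := by
  simp only [curvaturePairing, ← sum_curvatureUp_mul_cov2, Finset.mul_sum]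
  refine Finset.sum_congr rfl fun l _ => ?_
  rw [Finset.sum_comm]
  simp only [mul_left_comm (K.covBar2 f l _), mul_assoc]

lemma pairing2_eq_sum_dBar_mul_d (f h : R) : K.pairing2 f h =
    ∑ l, ∑ p, K.dBar l (∑ q, K.gInv q p * K.dBar q f) * K.d p (∑ k, K.gInv l k * K.d k h) := by
  refine Finset.sum_congr rfl fun l _ => ?_
  calc ∑ q, K.covBar2 f l q * K.grad l (K.grad q h)
      = ∑ q, ∑ p, K.gInv q p * K.covBar2 f l q * K.d p (K.grad l h) := by
        simp only [K.grad_comm l, K.grad_apply _ (K.grad l h), Finset.mul_sum,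
          mul_left_comm (K.covBar2 f l _), mul_assoc]
    _ = _ := by
        rw [Finset.sum_comm]
        simp only [← Finset.sum_mul, sum_gInv_mul_covBar2, ← grad_apply]

lemma pairing2_eq_sum_coordinates (f h : R) : K.pairing2 f h =
    ∑ l, ∑ k, ∑ q, ∑ p,
      (K.gInv q p * K.gInv l k * K.dBar l (K.dBar q f) * K.d k (K.d p h)
        + K.gInv q p * K.d p (K.gInv l k) * K.dBar l (K.dBar q f) * K.d k h
        + K.dBar l (K.gInv q p) * K.gInv l k * K.dBar q f * K.d k (K.d p h)
        + K.dBar l (K.gInv q p) * K.d p (K.gInv l k) * K.dBar q f * K.d k h) := by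
  rw [pairing2_eq_sum_dBar_mul_d]
  refine Finset.sum_congr rfl fun l _ => ?_
  simp only [map_sum, Finset.sum_mul_sum]
  rw [Finset.sum_comm_cycle]
  refine Finset.sum_congr rfl fun k _ => ?_
  rw [Finset.sum_comm]
  refine Finset.sum_congr rfl fun q _ => Finset.sum_congr rfl fun p _ => ?_
  simp only [Derivation.leibniz, smul_eq_mul, K.d_comm p k]
  ring

/-- The generators `a` of the algebra on which left star-multiplication is known to be `a + ν δ`:
the holomorphic elements (`δ = 0`) and `∂_k Φ` (`δ = ∂_k`). -/
inductive IsGenerator : R → Derivation 𝕜 R R → Prop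
  | holomorphic (a : R) (ha : ∀ l, K.dBar l a = 0) : IsGenerator a 0
  | potential (k : ι) : IsGenerator (K.d k K.pot) (K.d k)

variable {K} {a : R} {δ : Derivation 𝕜 R R}

namespace IsGenerator

lemma sum_dBar_mul_grad (ha : K.IsGenerator a δ) (f : R) :
    ∑ l, K.dBar l a * K.grad l f = δ f := by
  cases ha with
  | holomorphic a ha => simp [ha]
  | potential k => simpa only [g, Matrix.of_apply, K.d_dBar] using K.sum_g_mul_grad k f

lemma apply_dBar (ha : K.IsGenerator a δ) (l : ι) (f : R) : δ (K.dBar l f) = K.dBar l (δ f) := by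
  cases ha with
  | holomorphic a ha => simp
  | potential k => exact K.d_dBar k l f

lemma apply_dBar_pot (ha : K.IsGenerator a δ) (l : ι) : δ (K.dBar l K.pot) = K.dBar l a := by
  rw [← ha.sum_dBar_mul_grad]
  simp [grad_dBar_pot, Matrix.one_apply]

lemma covBar2_eq_zero (ha : K.IsGenerator a δ) (l q : ι) : K.covBar2 a l q = 0 := by
  rw [covBar2, ← ha.apply_dBar_pot l, ← ha.apply_dBar, ← ha.sum_dBar_mul_grad, sub_eq_zero]
  simp only [christoffelBar_eq_grad, mul_comm]

lemma covBar2_mul (ha : K.IsGenerator a δ) (f : R) (l q : ι) : K.covBar2 (a * f) l q =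
    a * K.covBar2 f l q + K.dBar l a * K.dBar q f + K.dBar q a * K.dBar l f := by
  have h : K.covBar2 (a * f) l q = a * K.covBar2 f l q + f * K.covBar2 a l q
      + K.dBar l a * K.dBar q f + K.dBar q a * K.dBar l f := by
    simp only [covBar2, Derivation.leibniz, smul_eq_mul, map_add, mul_add, mul_sub,
      Finset.sum_add_distrib, Finset.mul_sum, mul_left_comm (K.christoffelBar _ _ _)]
    ring
  simpa only [ha.covBar2_eq_zero, mul_zero, add_zero] using h

lemma covBar3_mul (ha : K.IsGenerator a δ) (f : R) (l q t : ι) : K.covBar3 (a * f) l q t =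
    a * K.covBar3 f l q t + K.dBar l a * K.covBar2 f q t + K.dBar q a * K.covBar2 f l t
      + K.dBar t a * K.covBar2 f l q := by
  have hf : ∀ l, ∑ m, K.christoffelBar t l m * K.dBar m f
      = K.dBar t (K.dBar l f) - K.covBar2 f l t := fun l => (sub_sub_cancel _ _).symm
  have hΓa : ∀ l, ∑ m, K.christoffelBar t l m * K.dBar m a = K.dBar t (K.dBar l a) := fun l =>
    (sub_eq_zero.mp (ha.covBar2_eq_zero l t)).symm
  have hΓ : ∀ l q, ∑ m, K.christoffelBar t l m * K.covBar2 (a * f) m q =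
      a * ∑ m, K.christoffelBar t l m * K.covBar2 f m q + K.dBar t (K.dBar l a) * K.dBar q f
        + K.dBar q a * (K.dBar t (K.dBar l f) - K.covBar2 f l t) := fun l q => by
    simp only [← hf, ← hΓa, ha.covBar2_mul, Finset.mul_sum, Finset.sum_mul,
      ← Finset.sum_add_distrib]
    exact Finset.sum_congr rfl fun m _ => by ring
  have hΓ' := hΓ q l
  simp only [K.covBar2_symm _ _ l] at hΓ'
  rw [covBar3, hΓ, hΓ', ha.covBar2_mul]
  simp only [covBar3, map_add, Derivation.leibniz, smul_eq_mul]
  ring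

lemma pairing1_mul (ha : K.IsGenerator a δ) (f h : R) :
    K.pairing1 (a * f) h = a * K.pairing1 f h + f * δ h := by
  simp only [pairing1, Derivation.leibniz, smul_eq_mul, add_mul, Finset.sum_add_distrib,
    ← ha.sum_dBar_mul_grad h, Finset.mul_sum, mul_assoc]

lemma apply_pairing1 (ha : K.IsGenerator a δ) (f h : R) :
    δ (K.pairing1 f h) = K.pairing1 (δ f) h + ∑ q, K.dBar q f * δ (K.grad q h) := by
  simp only [pairing1, map_sum, Derivation.leibniz, smul_eq_mul, ha.apply_dBar,
    Finset.sum_add_distrib, mul_comm (K.grad _ h)]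
  exact add_comm _ _

lemma sum_covBar2_mul (ha : K.IsGenerator a δ) (f : R) (T : ι → ι → R)
    (hT : ∀ l q, T l q = T q l) : ∑ l, ∑ q, K.covBar2 (a * f) l q * T l q =
      a * ∑ l, ∑ q, K.covBar2 f l q * T l q
        + 2 * ∑ q, K.dBar q f * ∑ l, K.dBar l a * T l q := by
  have hswap : ∑ l, ∑ q, K.dBar l a * K.dBar q f * T l q
      = ∑ q, K.dBar q f * ∑ l, K.dBar l a * T l q := by
    rw [Finset.sum_comm]
    simp only [Finset.mul_sum, mul_assoc, mul_left_comm]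
  have hsymm : ∑ l, ∑ q, K.dBar q a * K.dBar l f * T l q
      = ∑ q, K.dBar q f * ∑ l, K.dBar l a * T l q := by
    simp only [Finset.mul_sum, mul_assoc, mul_left_comm, hT]
  simp only [ha.covBar2_mul, add_mul, Finset.sum_add_distrib, hswap, hsymm, mul_assoc a,
    ← Finset.mul_sum]
  ring

lemma pairing2_mul (ha : K.IsGenerator a δ) (f h : R) : K.pairing2 (a * f) h =
    a * K.pairing2 f h + 2 * ∑ q, K.dBar q f * δ (K.grad q h) := by
  simpa only [pairing2, ha.sum_dBar_mul_grad] using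
    ha.sum_covBar2_mul f (fun l q => K.grad l (K.grad q h)) fun l q => K.grad_comm l q h

lemma apply_covBar2 (ha : K.IsGenerator a δ) (f : R) (l q : ι) : δ (K.covBar2 f l q) =
    K.covBar2 (δ f) l q - ∑ m, δ (K.grad m (K.dBar q (K.dBar l K.pot))) * K.dBar m f := by
  simp only [covBar2, christoffelBar_eq_grad, map_sub, map_sum, Derivation.leibniz, smul_eq_mul,
    ha.apply_dBar, Finset.sum_add_distrib, mul_comm (K.dBar _ f)]
  ring

lemma apply_pairing2 (ha : K.IsGenerator a δ) (f h : R) : δ (K.pairing2 f h) =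
    K.pairing2 (δ f) h + ∑ l, ∑ q, K.covBar2 f l q * δ (K.grad l (K.grad q h))
      - ∑ m, K.dBar m f * ∑ l, ∑ q,
          δ (K.grad m (K.dBar l (K.dBar q K.pot))) * K.grad l (K.grad q h) := by
  have hΓ : ∑ l, ∑ q,
      K.grad l (K.grad q h) * ∑ m, δ (K.grad m (K.dBar q (K.dBar l K.pot))) * K.dBar m f
        = ∑ m, K.dBar m f * ∑ l, ∑ q,
            δ (K.grad m (K.dBar l (K.dBar q K.pot))) * K.grad l (K.grad q h) := by
    simp only [Finset.mul_sum]
    rw [Finset.sum_comm_cycle]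
    exact Finset.sum_congr rfl fun m _ => Finset.sum_congr rfl fun l _ =>
      Finset.sum_congr rfl fun q _ => by rw [K.dBar_comm l q]; ring
  simp only [pairing2, map_sum, Derivation.leibniz, smul_eq_mul, ha.apply_covBar2, mul_sub,
    Finset.sum_add_distrib, Finset.sum_sub_distrib, hΓ]
  simp only [mul_comm (K.grad _ _)]
  ring

lemma pairing3_mul (ha : K.IsGenerator a δ) (f h : R) : K.pairing3 (a * f) h =
    a * K.pairing3 f h + 3 * ∑ l, ∑ q, K.covBar2 f l q * δ (K.grad l (K.grad q h)) := by
  let S : R := ∑ q, ∑ t, K.covBar2 f q t * ∑ l, K.dBar l a * K.grad l (K.grad q (K.grad t h))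
  have h1 : ∑ l, ∑ q, ∑ t,
      K.dBar l a * K.covBar2 f q t * K.grad l (K.grad q (K.grad t h)) = S := by
    rw [← Finset.sum_comm_cycle]
    simp only [S, Finset.mul_sum, mul_assoc, mul_left_comm]
  have h2 : ∑ l, ∑ q, ∑ t,
      K.dBar q a * K.covBar2 f l t * K.grad l (K.grad q (K.grad t h)) = S := by
    rw [← h1, Finset.sum_comm]
    simp only [K.grad_comm]
  have h3 : ∑ l, ∑ q, ∑ t,
      K.dBar t a * K.covBar2 f l q * K.grad l (K.grad q (K.grad t h)) = S := by
    simp only [S, Finset.mul_sum, mul_assoc, mul_left_comm, K.grad_comm]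
  simp only [← ha.sum_dBar_mul_grad]
  simp only [pairing3, ha.covBar3_mul, add_mul, Finset.sum_add_distrib, h1, h2, h3, mul_assoc a,
    ← Finset.mul_sum]
  ring

lemma curvaturePairing_mul (ha : K.IsGenerator a δ) (f h : R) : K.curvaturePairing (a * f) h =
    a * K.curvaturePairing f h
      - 2 * ∑ m, K.dBar m f * ∑ l, ∑ q,
          δ (K.grad m (K.dBar l (K.dBar q K.pot))) * K.grad l (K.grad q h) := by
  have hcontract : ∀ m, ∑ l, K.dBar l a *
      -∑ b, ∑ t, K.grad l (K.grad m (K.dBar b (K.dBar t K.pot))) * K.grad b (K.grad t h)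
        = -∑ b, ∑ t, δ (K.grad m (K.dBar b (K.dBar t K.pot))) * K.grad b (K.grad t h) := fun m => by
    simp only [← ha.sum_dBar_mul_grad, mul_neg, Finset.sum_neg_distrib, Finset.mul_sum,
      Finset.sum_mul, mul_assoc]
    rw [Finset.sum_comm_cycle, Finset.sum_comm_cycle]
  have hmul := ha.sum_covBar2_mul f (fun l q =>
    -∑ b, ∑ t, K.grad l (K.grad q (K.dBar b (K.dBar t K.pot))) * K.grad b (K.grad t h))
    fun l q => by simp only [K.grad_comm l q]
  simp only [hcontract, mul_neg (K.dBar _ f), Finset.sum_neg_distrib] at hmul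
  rw [curvaturePairing, hmul, curvaturePairing]
  ring

end IsGenerator

variable (K) in
/-- The kernel of the character `ev` (evaluation at a point `x`) is generated as an ideal by the
elements `a - a(x)` with `a` a generator in the sense of `IsGenerator`. -/
def IsGeneratedAt (ev : R →ₐ[𝕜] 𝕜) : Prop :=
  ∀ f, ev f = 0 →
    f ∈ Ideal.span {b | ∃ a δ, K.IsGenerator a δ ∧ b = a - algebraMap 𝕜 R (ev a)}

lemma isGenerator_algebraMap (s : 𝕜) : K.IsGenerator (algebraMap 𝕜 R s) 0 :=
  .holomorphic _ fun l => (K.dBar l).map_algebraMap s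

lemma isGenerator_one : K.IsGenerator 1 0 := map_one (algebraMap 𝕜 R) ▸ isGenerator_algebraMap 1

lemma IsGeneratedAt.eval_eq_zero {ev : R →ₐ[𝕜] 𝕜} (hev : K.IsGeneratedAt ev) (A : R →+ R)
    (hA : ∀ a δ, K.IsGenerator a δ → ∀ f, A (a * f) = a * A f) (hA1 : A 1 = 0) (f : R) :
    ev (A f) = 0 := by
  have hspan : ∀ b ∈ Ideal.span {b | ∃ a δ, K.IsGenerator a δ ∧ b = a - algebraMap 𝕜 R (ev a)},
      ∀ f, ev (A (f * b)) = 0 := fun b hb => by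
    induction hb using Submodule.span_induction with
    | mem b hb =>
      obtain ⟨a, δ, ha, rfl⟩ := hb
      intro f
      rw [mul_comm, sub_mul, map_sub, hA a δ ha, hA _ _ (isGenerator_algebraMap _)]
      simp
    | zero => simp
    | add b b' _ _ hb hb' => intro f; rw [mul_add, map_add, map_add, hb, hb', add_zero]
    | smul r b _ hb => intro f; rw [smul_eq_mul, ← mul_assoc, hb]
  have hsub : ev (A (f - algebraMap 𝕜 R (ev f))) = 0 := by
    simpa only [one_mul] using hspan _ (hev _ (by simp)) 1
  have hconst : A (algebraMap 𝕜 R (ev f)) = 0 := by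
    rw [← mul_one (algebraMap 𝕜 R (ev f)), hA _ _ (isGenerator_algebraMap _), hA1, mul_zero]
  simpa only [map_sub, hconst, map_zero, sub_zero] using hsub

variable (K) in
/-- The coefficients `c r` of an associative product `∑ r, ν ^ r * c r f h` in which left
multiplication by a generator `a` is `a + ν δ`, see `IsGenerator`. -/
structure IsStandardStar (c : ℕ → R → R → R) : Prop where
  add_left : ∀ r f f' h, c r (f + f') h = c r f h + c r f' h
  zeroth : ∀ f h, c 0 f h = f * h
  assoc : ∀ r f f' h, ∑ a ∈ Finset.HasAntidiagonal.antidiagonal r, c a.1 (c a.2 f f') h =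
    ∑ a ∈ Finset.HasAntidiagonal.antidiagonal r, c a.1 f (c a.2 f' h)
  generator_one : ∀ a δ, K.IsGenerator a δ → ∀ h, c 1 a h = δ h
  generator_add_two : ∀ a δ, K.IsGenerator a δ → ∀ r h, c (r + 2) a h = 0

namespace IsStandardStar

variable {c : ℕ → R → R → R} (hc : K.IsStandardStar c)
include hc

lemma zero_left (r : ℕ) (h : R) : c r 0 h = 0 := by
  simpa using hc.add_left r 0 0 h

lemma one_left (r : ℕ) (h : R) : c (r + 1) 1 h = 0 := by
  cases r with
  | zero => exact hc.generator_one 1 0 isGenerator_one h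
  | succ r => exact hc.generator_add_two 1 0 isGenerator_one r h

/-- The coefficient of `ν ^ (r + 1)` in `(a * f) * h = a * (f * h)`, where `*` is the
star-product. -/
lemma generator_mul (ha : K.IsGenerator a δ) (r : ℕ) (f h : R) :
    c (r + 1) (a * f) h = a * c (r + 1) f h + δ (c r f h) - c r (δ f) h := by
  have hright : ∑ x ∈ Finset.HasAntidiagonal.antidiagonal (r + 1), c x.1 a (c x.2 f h)
      = a * c (r + 1) f h + δ (c r f h) := by
    rw [Finset.Nat.sum_antidiagonal_succ, Finset.Nat.sum_antidiagonal_eq_sum_range_succ_mk,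
      Finset.sum_range_succ']
    simp [hc.generator_one a δ ha, hc.generator_add_two a δ ha, hc.zeroth]
  have hleft : ∑ x ∈ Finset.HasAntidiagonal.antidiagonal (r + 1), c x.1 (c x.2 a f) h
      = c (r + 1) (a * f) h + c r (δ f) h := by
    have hzero : ∀ i ∈ Finset.range r, c i (c (r + 1 - i) a f) h = 0 := fun i hi => by
      obtain ⟨j, rfl⟩ := Nat.exists_eq_add_of_lt (Finset.mem_range.mp hi)
      rw [show i + j + 1 + 1 - i = j + 2 by omega, hc.generator_add_two a δ ha, hc.zero_left]
    rw [Finset.Nat.sum_antidiagonal_eq_sum_range_succ_mk, Finset.sum_range_succ,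
      Finset.sum_range_succ, Finset.sum_eq_zero hzero]
    simp [hc.zeroth, hc.generator_one a δ ha, add_comm]
  rw [← hright, ← hc.assoc, hleft, add_sub_cancel_right]

section Uniqueness

variable {X : Type*} {ev : X → R →ₐ[𝕜] 𝕜} (hev : ∀ x, K.IsGeneratedAt (ev x))
  (hinj : ∀ f, (∀ x, ev x f = 0) → f = 0)
include hev hinj

lemma eq_of_generator_mul (r : ℕ) (B : R → R → R)
    (hadd : ∀ f f' h, B (f + f') h = B f h + B f' h) (hone : ∀ h, B 1 h = 0)
    (hmul : ∀ a δ, K.IsGenerator a δ → ∀ f h,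
      B (a * f) h = a * B f h + δ (c r f h) - c r (δ f) h) (f h : R) :
    c (r + 1) f h = B f h := by
  let A : R →+ R := AddMonoidHom.mk' (fun f => c (r + 1) f h - B f h) fun f f' => by
    rw [hc.add_left, hadd]
    ring
  refine sub_eq_zero.mp (hinj _ fun x => (hev x).eval_eq_zero A (fun a δ ha f => ?_) ?_ f)
  · simp only [A, AddMonoidHom.mk'_apply, hc.generator_mul ha, hmul a δ ha]
    ring
  · simp only [A, AddMonoidHom.mk'_apply, hc.one_left, hone, sub_zero]

theorem coeff_one_eq (f h : R) : c 1 f h = K.pairing1 f h := by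
  refine hc.eq_of_generator_mul hev hinj 0 K.pairing1 (fun f f' h => ?_) (fun h => ?_)
    (fun a δ ha f h => ?_) f h
  · simp [pairing1, add_mul, Finset.sum_add_distrib]
  · simp [pairing1]
  · rw [ha.pairing1_mul, hc.zeroth, hc.zeroth, Derivation.leibniz, smul_eq_mul, smul_eq_mul]
    ring

end Uniqueness

end IsStandardStar

variable (K)

lemma covBar2_add (f f' : R) (l q : ι) :
    K.covBar2 (f + f') l q = K.covBar2 f l q + K.covBar2 f' l q := by
  simp only [covBar2, map_add, mul_add, Finset.sum_add_distrib]
  ring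

lemma covBar3_add (f f' : R) (l q t : ι) :
    K.covBar3 (f + f') l q t = K.covBar3 f l q t + K.covBar3 f' l q t := by
  simp only [covBar3, covBar2_add, map_add, mul_add, Finset.sum_add_distrib]
  ring

lemma covBar2_one (l q : ι) : K.covBar2 1 l q = 0 := isGenerator_one.covBar2_eq_zero l q

lemma covBar3_one (l q t : ι) : K.covBar3 1 l q t = 0 := by
  simp [covBar3, covBar2_one]

end KahlerAlgebra

end KahlerAlgebras

section KahlerAlgebrasOverFields

namespace KahlerAlgebra.IsStandardStar

variable {𝕜 ι R : Type*} [Field 𝕜] [CharZero 𝕜] [Fintype ι] [DecidableEq ι] [CommRing R]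
  [Algebra 𝕜 R] {K : KahlerAlgebra 𝕜 ι R} {c : ℕ → R → R → R} (hc : K.IsStandardStar c)
  {X : Type*} {ev : X → R →ₐ[𝕜] 𝕜} (hev : ∀ x, K.IsGeneratedAt (ev x))
  (hinj : ∀ f, (∀ x, ev x f = 0) → f = 0)
include hc hev hinj

theorem coeff_two_eq (f h : R) : c 2 f h = (1 / 2 : 𝕜) • K.pairing2 f h := by
  refine hc.eq_of_generator_mul hev hinj 1 (fun f h => (1 / 2 : 𝕜) • K.pairing2 f h)
    (fun f f' h => ?_) (fun h => ?_) (fun a δ ha f h => ?_) f h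
  · simp only [pairing2, covBar2_add, add_mul, Finset.sum_add_distrib, smul_add]
  · simp [pairing2, covBar2_one]
  · simp only [hc.coeff_one_eq hev hinj, ha.pairing2_mul, ha.apply_pairing1, two_mul, smul_add,
      mul_smul_comm]
    module

theorem coeff_three_eq (f h : R) :
    c 3 f h = (1 / 6 : 𝕜) • K.pairing3 f h + (1 / 4 : 𝕜) • K.curvaturePairing f h := by
  refine hc.eq_of_generator_mul hev hinj 2
    (fun f h => (1 / 6 : 𝕜) • K.pairing3 f h + (1 / 4 : 𝕜) • K.curvaturePairing f h)
    (fun f f' h => ?_) (fun h => ?_) (fun a δ ha f h => ?_) f h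
  · simp only [pairing3, curvaturePairing, covBar2_add, covBar3_add, add_mul,
      Finset.sum_add_distrib]
    module
  · simp [pairing3, curvaturePairing, covBar2_one, covBar3_one]
  · simp only [hc.coeff_two_eq hev hinj, ha.pairing3_mul, ha.curvaturePairing_mul,
      Derivation.map_smul, ha.apply_pairing2, two_mul, mul_add, mul_smul_comm,
      show (3 : R) = 1 + 1 + 1 by norm_num, add_mul, one_mul]
    module

end KahlerAlgebra.IsStandardStar

end KahlerAlgebrasOverFields

section SegmentAverage

variable {V E : Type*} [NormedAddCommGroup V] [NormedSpace ℝ V] [NormedAddCommGroup E]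
  {B : Set V} {G : V → E} {y z : V}

lemma continuousOn_comp_segment (hconv : Convex ℝ B) (hG : ContinuousOn G B) (hy : y ∈ B)
    (hz : z ∈ B) : ContinuousOn (fun t : ℝ => G (y + t • (z - y))) (Set.uIcc 0 1) := by
  rw [Set.uIcc_of_le zero_le_one]
  exact hG.comp (by fun_prop) fun t ht => hconv.add_smul_sub_mem hy hz ht

lemma exists_eventually_norm_comp_segment_le (hB : IsOpen B) (hconv : Convex ℝ B)
    (hG : ContinuousOn G B) (hy : y ∈ B) (hz : z ∈ B) :
    ∃ C, ∀ᶠ w in 𝓝 z, ∀ t ∈ Set.Icc (0 : ℝ) 1, ‖G (y + t • (w - y))‖ ≤ C := by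
  have hcont : ∀ t ∈ Set.Icc (0 : ℝ) 1,
      ContinuousAt (fun p : V × ℝ => ‖G (y + p.2 • (p.1 - y))‖) (z, t) := fun t ht =>
    ((hG.continuousAt (hB.mem_nhds (hconv.add_smul_sub_mem hy hz ht))).comp_of_eq
      (f := fun p : V × ℝ => y + p.2 • (p.1 - y)) (by fun_prop) rfl).norm
  have hseg := continuousOn_comp_segment hconv hG hy hz
  rw [Set.uIcc_of_le zero_le_one] at hseg
  obtain ⟨C, hC⟩ := isCompact_Icc.exists_bound_of_continuousOn hseg
  refine ⟨C + 1, isCompact_Icc.eventually_forall_of_forall_eventually fun t ht => ?_⟩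
  exact ((hcont t ht).eventually_lt_const (lt_add_of_le_of_pos (hC t ht) one_pos)).mono
    fun _ => le_of_lt

variable [NormedSpace ℝ E]

lemma hasFDerivAt_comp_segment (t : ℝ) (hG : DifferentiableAt ℝ G (y + t • (z - y))) :
    HasFDerivAt (fun z => G (y + t • (z - y))) (t • fderiv ℝ G (y + t • (z - y))) z := by
  have hseg : HasFDerivAt (fun z : V => y + t • (z - y)) (t • ContinuousLinearMap.id ℝ V) z :=
    (((hasFDerivAt_id z).sub_const y).const_smul t).const_add y
  simpa only [Function.comp_def, ContinuousLinearMap.comp_smul, ContinuousLinearMap.comp_id]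
    using hG.hasFDerivAt.comp z hseg

lemma hasFDerivAt_integral_segment (hB : IsOpen B) (hconv : Convex ℝ B) (hG : ContDiffOn ℝ 1 G B)
    (hy : y ∈ B) (hz : z ∈ B) {w : ℝ → ℝ} (hw : Continuous w) :
    HasFDerivAt (fun z => ∫ t in (0 : ℝ)..1, w t • G (y + t • (z - y)))
      (∫ t in (0 : ℝ)..1, (w t * t) • fderiv ℝ G (y + t • (z - y))) z := by
  have hG' : ContinuousOn (fderiv ℝ G) B := hG.continuousOn_fderiv_of_isOpen hB le_rfl
  have hI : ∀ {t : ℝ}, t ∈ Set.uIoc 0 1 → t ∈ Set.Icc (0 : ℝ) 1 := fun ht => by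
    rw [Set.uIoc_of_le zero_le_one] at ht
    exact ⟨ht.1.le, ht.2⟩
  have hcont : ∀ z ∈ B, ContinuousOn (fun t => w t • G (y + t • (z - y))) (Set.uIcc 0 1) :=
    fun z hz => hw.continuousOn.smul (continuousOn_comp_segment hconv hG.continuousOn hy hz)
  have hcont' : ContinuousOn (fun t => (w t * t) • fderiv ℝ G (y + t • (z - y))) (Set.uIcc 0 1) :=
    (hw.mul continuous_id).continuousOn.smul (continuousOn_comp_segment hconv hG' hy hz)
  obtain ⟨C, hC⟩ := exists_eventually_norm_comp_segment_le hB hconv hG' hy hz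
  refine intervalIntegral.hasFDerivAt_integral_of_dominated_of_fderiv_le
    (F' := fun z t => (w t * t) • fderiv ℝ G (y + t • (z - y)))
    (bound := fun t => |w t * t| * C) (Filter.inter_mem (hB.mem_nhds hz) hC) ?_ ?_ ?_ ?_ ?_ ?_
  · filter_upwards [hB.mem_nhds hz] with z hz
    exact ((hcont z hz).mono Set.uIoc_subset_uIcc).aestronglyMeasurable measurableSet_uIoc
  · exact (hcont z hz).intervalIntegrable
  · exact (hcont'.mono Set.uIoc_subset_uIcc).aestronglyMeasurable measurableSet_uIoc
  · refine .of_forall fun t ht z hz => ?_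
    rw [norm_smul, Real.norm_eq_abs]
    exact mul_le_mul_of_nonneg_left (hz.2 t (hI ht)) (abs_nonneg _)
  · exact ((hw.mul continuous_id).abs.mul continuous_const).intervalIntegrable _ _
  · refine .of_forall fun t ht z hz => ?_
    rw [mul_smul]
    exact (hasFDerivAt_comp_segment t ((hG.differentiableOn one_ne_zero).differentiableAt
      (hB.mem_nhds (hconv.add_smul_sub_mem hy hz.1 (hI ht))))).const_smul (w t)

universe u in
lemma contDiffOn_nat_integral_segment {V E : Type u} [NormedAddCommGroup V] [NormedSpace ℝ V]
    [NormedAddCommGroup E] [NormedSpace ℝ E] {B : Set V} {G : V → E} {y : V} (hB : IsOpen B)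
    (hconv : Convex ℝ B) (hG : ContDiffOn ℝ ∞ G B) (hy : y ∈ B) {w : ℝ → ℝ} (hw : Continuous w)
    (m : ℕ) :
    ContDiffOn ℝ m (fun z => ∫ t in (0 : ℝ)..1, w t • G (y + t • (z - y))) B := by
  induction m generalizing E w with
  | zero =>
    exact contDiffOn_zero.mpr fun z hz => (hasFDerivAt_integral_segment hB hconv
      (hG.of_le (mod_cast le_top)) hy hz hw).continuousAt.continuousWithinAt
  | succ m ih =>
    have hderiv := fun z hz =>
      hasFDerivAt_integral_segment hB hconv (hG.of_le (mod_cast le_top)) hy (z := z) hz hw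
    rw [Nat.cast_succ]
    refine (contDiffOn_succ_iff_fderiv_of_isOpen hB).mpr
      ⟨fun z hz => (hderiv z hz).differentiableAt.differentiableWithinAt,
        fun h => absurd h (WithTop.coe_ne_top), ?_⟩
    exact (ih ((contDiffOn_infty_iff_fderiv_of_isOpen hB).mp hG).2
      (hw.mul continuous_id)).congr fun z hz => (hderiv z hz).fderiv

/-- The average of `G` over the segment from `y` to `z`. It provides the coefficients of
Hadamard's lemma, see `apply_segmentAverage_fderiv`. -/
noncomputable def segmentAverage (y : V) (G : V → E) (z : V) : E :=
  ∫ t in (0 : ℝ)..1, G (y + t • (z - y))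

universe u in
lemma contDiffOn_segmentAverage {V E : Type u} [NormedAddCommGroup V] [NormedSpace ℝ V]
    [NormedAddCommGroup E] [NormedSpace ℝ E] {B : Set V} {G : V → E} {y : V} (hB : IsOpen B)
    (hconv : Convex ℝ B) (hG : ContDiffOn ℝ ∞ G B) (hy : y ∈ B) :
    ContDiffOn ℝ ∞ (segmentAverage y G) B :=
  contDiffOn_infty.mpr fun m => by
    simpa only [one_smul] using!
      contDiffOn_nat_integral_segment hB hconv hG hy (w := fun _ => 1) continuous_const m

lemma segmentAverage_congr (hconv : Convex ℝ B) {G' : V → E} (h : Set.EqOn G G' B) (hy : y ∈ B)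
    (hz : z ∈ B) : segmentAverage y G z = segmentAverage y G' z :=
  intervalIntegral.integral_congr fun t ht => by
    rw [Set.uIcc_of_le zero_le_one] at ht
    exact h (hconv.add_smul_sub_mem hy hz ht)

lemma segmentAverage_clm_comp [CompleteSpace E] {E' : Type*} [NormedAddCommGroup E']
    [NormedSpace ℝ E'] [CompleteSpace E'] (T : E →L[ℝ] E') (hconv : Convex ℝ B)
    (hG : ContinuousOn G B) (hy : y ∈ B) (hz : z ∈ B) :
    segmentAverage y (fun z => T (G z)) z = T (segmentAverage y G z) :=
  T.intervalIntegral_comp_comm (continuousOn_comp_segment hconv hG hy hz).intervalIntegrable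

lemma apply_segmentAverage_fderiv [CompleteSpace E] (hB : IsOpen B) (hconv : Convex ℝ B)
    (hG : ContDiffOn ℝ 1 G B) (hy : y ∈ B) (hz : z ∈ B) :
    segmentAverage y (fderiv ℝ G) z (z - y) = G z - G y := by
  have hG' : ContinuousOn (fderiv ℝ G) B := hG.continuousOn_fderiv_of_isOpen hB le_rfl
  have hderiv : ∀ t ∈ Set.uIcc (0 : ℝ) 1, HasDerivAt (fun t : ℝ => G (y + t • (z - y)))
      (fderiv ℝ G (y + t • (z - y)) (z - y)) t := fun t ht => by
    rw [Set.uIcc_of_le zero_le_one] at ht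
    have hseg : HasDerivAt (fun t : ℝ => y + t • (z - y)) (z - y) t := by
      simpa using ((hasDerivAt_id t).smul_const (z - y)).const_add y
    exact ((hG.differentiableOn one_ne_zero).differentiableAt (hB.mem_nhds
      (hconv.add_smul_sub_mem hy hz ht))).hasFDerivAt.comp_hasDerivAt t hseg
  have hint : IntervalIntegrable (fun t : ℝ => fderiv ℝ G (y + t • (z - y)))
      MeasureTheory.volume 0 1 := (continuousOn_comp_segment hconv hG' hy hz).intervalIntegrable
  rw [segmentAverage, ContinuousLinearMap.intervalIntegral_apply hint,
    intervalIntegral.integral_eq_sub_of_hasDerivAt hderiv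
      ((continuousOn_comp_segment hconv hG' hy hz).clm_apply
        continuousOn_const).intervalIntegrable]
  simp

lemma norm_segmentAverage_sub_le [CompleteSpace E] (hconv : Convex ℝ B) (hG : ContinuousOn G B)
    (hy : y ∈ B) (hz : z ∈ B) {a : E} {ε : ℝ} (hε : ∀ w ∈ B, ‖G w - a‖ ≤ ε) :
    ‖segmentAverage y G z - a‖ ≤ ε := by
  have hsub : segmentAverage y G z - a = ∫ t in (0 : ℝ)..1, (G (y + t • (z - y)) - a) := by
    rw [intervalIntegral.integral_sub
      (continuousOn_comp_segment hconv hG hy hz).intervalIntegrable intervalIntegrable_const]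
    simp [segmentAverage]
  rw [hsub]
  refine (intervalIntegral.norm_integral_le_of_norm_le_const fun t ht => hε _ ?_).trans (by simp)
  rw [Set.uIoc_of_le zero_le_one] at ht
  exact hconv.add_smul_sub_mem hy hz ⟨ht.1.le, ht.2⟩

lemma exists_ball_segmentAverage_mem [CompleteSpace E] (hB : IsOpen B) (hz : z ∈ B)
    (hG : ContinuousOn G B) {O : Set E} (hO : O ∈ 𝓝 (G z)) :
    ∃ r > 0, Metric.ball z r ⊆ B ∧
      ∀ y ∈ Metric.ball z r, ∀ w ∈ Metric.ball z r, segmentAverage y G w ∈ O := by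
  obtain ⟨ε, hε, hεO⟩ := Metric.nhds_basis_closedBall.mem_iff.mp hO
  obtain ⟨r, hr, hball⟩ := Metric.nhds_basis_ball.mem_iff.mp (Filter.inter_mem (hB.mem_nhds hz)
    ((hG.continuousAt (hB.mem_nhds hz)) (Metric.closedBall_mem_nhds _ hε)))
  refine ⟨r, hr, fun w hw => (hball hw).1, fun y hy w hw => hεO (mem_closedBall_iff_norm.mpr ?_)⟩
  exact norm_segmentAverage_sub_le (convex_ball z r) (hG.mono fun w hw => (hball hw).1) hy hw
    fun w hw => mem_closedBall_iff_norm.mp (hball hw).2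

lemma exists_ball_det_segmentAverage_ne_zero {ι : Type*} [Fintype ι] [DecidableEq ι]
    {G : ι → ι → V → ℂ} (hB : IsOpen B) (hz : z ∈ B) (hG : ∀ k l, ContinuousOn (G k l) B)
    (hdet : (Matrix.of fun k l => G k l z).det ≠ 0) :
    ∃ r > 0, Metric.ball z r ⊆ B ∧ ∀ y ∈ Metric.ball z r, ∀ w ∈ Metric.ball z r,
      (Matrix.of fun k l => segmentAverage y (G k l) w).det ≠ 0 := by
  have hGpi : ContinuousOn (fun w k l => G k l w) B :=
    continuousOn_pi.mpr fun k => continuousOn_pi.mpr fun l => hG k l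
  have hopen : IsOpen {A : ι → ι → ℂ | (Matrix.of A).det ≠ 0} :=
    isOpen_ne_fun (Continuous.matrix_det continuous_id) continuous_const
  obtain ⟨r, hr, hrB, hmem⟩ := exists_ball_segmentAverage_mem hB hz hGpi (hopen.mem_nhds hdet)
  refine ⟨r, hr, hrB, fun y hy w hw => ?_⟩
  have hcomponents : (fun k l => segmentAverage y (G k l) w) =
      segmentAverage y (fun w k l => G k l w) w := funext₂ fun k l =>
    segmentAverage_clm_comp ((ContinuousLinearMap.proj (R := ℝ) (φ := fun _ => ℂ) l).comp
      (ContinuousLinearMap.proj (R := ℝ) (φ := fun _ => ι → ℂ) k)) (convex_ball z r)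
      (hGpi.mono hrB) hy hw
  rw [hcomponents]
  exact hmem y hy w hw

end SegmentAverage

section Wirtinger

variable {ι : Type*} [Fintype ι] [DecidableEq ι]

/-- The coefficient of `dz^k` in a real-linear form on `ℂⁿ`, so that `∂_k f` at `z` is
`wirtinger k (fderiv ℝ f z)`. -/
noncomputable def wirtinger (k : ι) : ((ι → ℂ) →L[ℝ] ℂ) →L[ℝ] ℂ :=
  (1 / 2 : ℂ) • (ContinuousLinearMap.apply ℝ ℂ (Pi.single k 1)
    - Complex.I • ContinuousLinearMap.apply ℝ ℂ (Pi.single k Complex.I))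

/-- The coefficient of `dz̄^k` in a real-linear form on `ℂⁿ`, so that `∂̄_k f` at `z` is
`wirtingerBar k (fderiv ℝ f z)`. -/
noncomputable def wirtingerBar (k : ι) : ((ι → ℂ) →L[ℝ] ℂ) →L[ℝ] ℂ :=
  (1 / 2 : ℂ) • (ContinuousLinearMap.apply ℝ ℂ (Pi.single k 1)
    + Complex.I • ContinuousLinearMap.apply ℝ ℂ (Pi.single k Complex.I))

lemma wirtinger_apply (k : ι) (L : (ι → ℂ) →L[ℝ] ℂ) :
    wirtinger k L = (L (Pi.single k 1) - Complex.I * L (Pi.single k Complex.I)) / 2 := by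
  simp only [wirtinger, smul_apply, sub_apply, ContinuousLinearMap.apply_apply, smul_eq_mul]
  ring

lemma wirtingerBar_apply (k : ι) (L : (ι → ℂ) →L[ℝ] ℂ) :
    wirtingerBar k L = (L (Pi.single k 1) + Complex.I * L (Pi.single k Complex.I)) / 2 := by
  simp only [wirtingerBar, smul_apply, add_apply, ContinuousLinearMap.apply_apply, smul_eq_mul]
  ring

lemma map_single_eq_wirtinger (L : (ι → ℂ) →L[ℝ] ℂ) (k : ι) (a : ℂ) :
    L (Pi.single k a) = a * wirtinger k L + starRingEnd ℂ a * wirtingerBar k L := by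
  have ha : (Pi.single k a : ι → ℂ)
      = a.re • (Pi.single k 1 : ι → ℂ) + a.im • (Pi.single k Complex.I : ι → ℂ) := by
    rw [← Pi.single_smul, ← Pi.single_smul, ← Pi.single_add]
    congr 1
    apply Complex.ext <;> simp
  have hLa : L (Pi.single k a) = a.re * L (Pi.single k 1) + a.im * L (Pi.single k Complex.I) := by
    rw [ha, map_add, map_smul, map_smul, Complex.real_smul, Complex.real_smul]
  have hconj : starRingEnd ℂ a = a.re - a.im * Complex.I := by apply Complex.ext <;> simp
  rw [hLa, wirtinger_apply, wirtingerBar_apply, hconj]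
  linear_combination (a.im * L (Pi.single k Complex.I)) * Complex.I_sq
    + (L (Pi.single k 1) - Complex.I * L (Pi.single k Complex.I)) / 2 * Complex.re_add_im a

lemma apply_eq_sum_wirtinger (L : (ι → ℂ) →L[ℝ] ℂ) (v : ι → ℂ) :
    L v = ∑ k, (v k * wirtinger k L + starRingEnd ℂ (v k) * wirtingerBar k L) := by
  conv_lhs => rw [← Finset.univ_sum_single v]
  simp only [map_sum, map_single_eq_wirtinger]

end Wirtinger

open TopologicalSpace (Opens)

noncomputable section

section SmoothAlgebra

lemma extend_val_eqOn {V : Type*} [TopologicalSpace V] {B : Opens V} {f : B → ℂ} {F : V → ℂ}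
    (h : ∀ z : B, f z = F z) :
    Set.EqOn (Function.extend Subtype.val f 0) F B := fun z hz =>
  (Subtype.val_injective.extend_apply f 0 ⟨z, hz⟩).trans (h ⟨z, hz⟩)

variable {V : Type*} [NormedAddCommGroup V] [NormedSpace ℝ V] {B : Opens V}

variable (B) in
/-- The algebra of smooth functions on an open set `B`. Smoothness is expressed through the
extension by zero, so that the Fréchet derivatives of functions on `V` can be used. -/
def smoothAlgebra : Subalgebra ℂ (B → ℂ) where
  carrier := {f | ContDiffOn ℝ ∞ (Function.extend Subtype.val f 0) B}
  mul_mem' {f h} hf hh := (ContDiffOn.mul hf hh).congr <| extend_val_eqOn fun z => by simp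
  add_mem' {f h} hf hh := (ContDiffOn.add hf hh).congr <| extend_val_eqOn fun z => by simp
  algebraMap_mem' c := (contDiffOn_const (c := c)).congr <| extend_val_eqOn fun _ => rfl

/-- The element of `smoothAlgebra B` defined by a function which is smooth on `B`. -/
def restrictSmooth (F : V → ℂ) (hF : ContDiffOn ℝ ∞ F B) : smoothAlgebra B :=
  ⟨fun z => F z, hF.congr (extend_val_eqOn fun _ => rfl)⟩

/-- The extension by zero of a smooth function on `B`. -/
def zeroExtend (F : smoothAlgebra B) : V → ℂ := Function.extend Subtype.val F.1 0

/-- The evaluation of smooth functions on `B` at a point. -/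
def evalAt (z : B) : smoothAlgebra B →ₐ[ℂ] ℂ :=
  (Pi.evalAlgHom ℂ (fun _ : B => ℂ) z).comp (smoothAlgebra B).val

lemma contDiffOn_zeroExtend (F : smoothAlgebra B) : ContDiffOn ℝ ∞ (zeroExtend F) B := F.2

lemma zeroExtend_apply (F : smoothAlgebra B) (z : B) : zeroExtend F z = evalAt z F :=
  Subtype.val_injective.extend_apply F.1 0 z

lemma evalAt_restrictSmooth (z : B) {F : V → ℂ} (hF : ContDiffOn ℝ ∞ F B) :
    evalAt z (restrictSmooth F hF) = F z := rfl

lemma smoothAlgebra_ext {F G : smoothAlgebra B} (h : ∀ z : B, evalAt z F = evalAt z G) : F = G :=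
  Subtype.ext (funext h)

lemma zeroExtend_eqOn {F : smoothAlgebra B} {f : V → ℂ} (h : ∀ z : B, evalAt z F = f z) :
    Set.EqOn (zeroExtend F) f B := extend_val_eqOn h

lemma differentiableAt_zeroExtend (F : smoothAlgebra B) (z : B) :
    DifferentiableAt ℝ (zeroExtend F) z :=
  ((contDiffOn_zeroExtend F).differentiableOn (by simp)).differentiableAt (B.isOpen.mem_nhds z.2)

lemma fderiv_zeroExtend {F : smoothAlgebra B} {f : V → ℂ} (h : ∀ z : B, evalAt z F = f z) (z : B) :
    fderiv ℝ (zeroExtend F) z = fderiv ℝ f z :=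
  (Filter.eventuallyEq_of_mem (B.isOpen.mem_nhds z.2) (zeroExtend_eqOn h)).fderiv_eq

lemma isUnit_of_evalAt_ne_zero {F : smoothAlgebra B} (hF : ∀ z : B, evalAt z F ≠ 0) : IsUnit F :=
  IsUnit.of_mul_eq_one (restrictSmooth (fun z => (zeroExtend F z)⁻¹)
    ((contDiffOn_zeroExtend F).inv fun z hz => (zeroExtend_apply F ⟨z, hz⟩).trans_ne (hF _)))
    (smoothAlgebra_ext fun z => by
      rw [map_mul, evalAt_restrictSmooth, zeroExtend_apply, mul_inv_cancel₀ (hF z), map_one])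

/-- The directional derivative along a constant vector field. -/
def directionalDerivation (v : V) : Derivation ℂ (smoothAlgebra B) (smoothAlgebra B) :=
  Derivation.mk'
    { toFun := fun F => restrictSmooth (fun z => fderiv ℝ (zeroExtend F) z v)
        (((contDiffOn_infty_iff_fderiv_of_isOpen B.isOpen).mp (contDiffOn_zeroExtend F)).2.clm_apply
          contDiffOn_const)
      map_add' := fun F G => smoothAlgebra_ext fun z => by
        rw [map_add, evalAt_restrictSmooth, evalAt_restrictSmooth, evalAt_restrictSmooth,
          fderiv_zeroExtend (f := zeroExtend F + zeroExtend G) (by simp [zeroExtend_apply]),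
          fderiv_add (differentiableAt_zeroExtend F z) (differentiableAt_zeroExtend G z), add_apply]
      map_smul' := fun c F => smoothAlgebra_ext fun z => by
        rw [RingHom.id_apply, map_smul, evalAt_restrictSmooth, evalAt_restrictSmooth,
          fderiv_zeroExtend (f := c • zeroExtend F) (by simp [zeroExtend_apply]),
          fderiv_const_smul_field]
        rfl }
    fun F G => smoothAlgebra_ext fun z => by
      simp only [LinearMap.coe_mk, AddHom.coe_mk, map_add, map_mul, smul_eq_mul,
        evalAt_restrictSmooth]
      rw [fderiv_zeroExtend (f := zeroExtend F * zeroExtend G) (by simp [zeroExtend_apply]),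
        fderiv_mul (differentiableAt_zeroExtend F z) (differentiableAt_zeroExtend G z)]
      simp [zeroExtend_apply]

lemma evalAt_directionalDerivation (v : V) (F : smoothAlgebra B) (z : B) :
    evalAt z (directionalDerivation v F) = fderiv ℝ (zeroExtend F) z v := rfl

lemma evalAt_directionalDerivation_directionalDerivation (v w : V) (F : smoothAlgebra B) (z : B) :
    evalAt z (directionalDerivation v (directionalDerivation w F))
      = fderiv ℝ (fderiv ℝ (zeroExtend F)) z v w := by
  have hF' := ((contDiffOn_infty_iff_fderiv_of_isOpen B.isOpen).mp (contDiffOn_zeroExtend F)).2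
  rw [evalAt_directionalDerivation,
    fderiv_zeroExtend (f := fun z => fderiv ℝ (zeroExtend F) z w) fun _ => rfl,
    fderiv_clm_apply ((hF'.differentiableOn (by simp)).differentiableAt (B.isOpen.mem_nhds z.2))
      (differentiableAt_const w)]
  simp

lemma directionalDerivation_comm (v w : V) (F : smoothAlgebra B) :
    directionalDerivation v (directionalDerivation w F)
      = directionalDerivation w (directionalDerivation v F) := smoothAlgebra_ext fun z => by
  rw [evalAt_directionalDerivation_directionalDerivation,
    evalAt_directionalDerivation_directionalDerivation]
  refine ((contDiffOn_zeroExtend F).contDiffAt (B.isOpen.mem_nhds z.2)).isSymmSndFDerivAt ?_ v w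
  rw [minSmoothness_of_isRCLikeNormedField]
  exact WithTop.coe_le_coe.mpr (le_top (a := (2 : ℕ∞)))

end SmoothAlgebra

section WirtingerDerivations

variable {ι : Type*} [Fintype ι] [DecidableEq ι] {B : Opens (ι → ℂ)}

/-- The derivation `∂_k = ∂/∂z^k`. -/
def holDerivation (k : ι) : Derivation ℂ (smoothAlgebra B) (smoothAlgebra B) :=
  (1 / 2 : ℂ) • (directionalDerivation (B := B) (Pi.single k 1)
    - Complex.I • directionalDerivation (B := B) (Pi.single k Complex.I))

/-- The derivation `∂̄_k = ∂/∂z̄^k`. -/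
def antiholDerivation (k : ι) : Derivation ℂ (smoothAlgebra B) (smoothAlgebra B) :=
  (1 / 2 : ℂ) • (directionalDerivation (B := B) (Pi.single k 1)
    + Complex.I • directionalDerivation (B := B) (Pi.single k Complex.I))

lemma evalAt_holDerivation (k : ι) (F : smoothAlgebra B) (z : B) :
    evalAt z (holDerivation k F) = wirtinger k (fderiv ℝ (zeroExtend F) z) := by
  simp only [holDerivation, Derivation.smul_apply, Derivation.sub_apply, map_smul, map_sub,
    evalAt_directionalDerivation, wirtinger_apply, smul_eq_mul]
  ring

lemma evalAt_antiholDerivation (k : ι) (F : smoothAlgebra B) (z : B) :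
    evalAt z (antiholDerivation k F) = wirtingerBar k (fderiv ℝ (zeroExtend F) z) := by
  simp only [antiholDerivation, Derivation.smul_apply, Derivation.add_apply, map_smul, map_add,
    evalAt_directionalDerivation, wirtingerBar_apply, smul_eq_mul]
  ring

lemma holDerivation_comm (k p : ι) (F : smoothAlgebra B) :
    holDerivation k (holDerivation p F) = holDerivation p (holDerivation k F) := by
  simp only [holDerivation, Derivation.smul_apply, Derivation.sub_apply, Derivation.map_smul,
    map_sub, directionalDerivation_comm (Pi.single p _)]
  module

lemma antiholDerivation_comm (k p : ι) (F : smoothAlgebra B) :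
    antiholDerivation k (antiholDerivation p F) = antiholDerivation p (antiholDerivation k F) := by
  simp only [antiholDerivation, Derivation.smul_apply, Derivation.add_apply, Derivation.map_smul,
    map_add, directionalDerivation_comm (Pi.single p _)]
  module

lemma holDerivation_antiholDerivation (k l : ι) (F : smoothAlgebra B) :
    holDerivation k (antiholDerivation l F) = antiholDerivation l (holDerivation k F) := by
  simp only [holDerivation, antiholDerivation, Derivation.smul_apply, Derivation.add_apply,
    Derivation.sub_apply, Derivation.map_smul, map_add, map_sub,
    directionalDerivation_comm (Pi.single l _)]
  module

end WirtingerDerivations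

section Hadamard

variable {ι : Type*} [Fintype ι] {B : Opens (ι → ℂ)}

/-- The coordinate function `z^k`. -/
def coord (k : ι) : smoothAlgebra B := restrictSmooth (fun z => z k) (by fun_prop)

/-- The conjugate coordinate function `z̄^k`. -/
def conjCoord (k : ι) : smoothAlgebra B :=
  restrictSmooth (fun z => starRingEnd ℂ (z k))
    (Complex.conjCLE.contDiff.comp_contDiffOn (by fun_prop))

lemma evalAt_coord (z : B) (k : ι) : evalAt z (coord k) = z.1 k := rfl

lemma evalAt_conjCoord (z : B) (k : ι) : evalAt z (conjCoord k) = starRingEnd ℂ (z.1 k) := rfl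

variable [DecidableEq ι]

lemma antiholDerivation_coord (l k : ι) : antiholDerivation l (coord k : smoothAlgebra B) = 0 :=
  smoothAlgebra_ext fun z => by
    rw [evalAt_antiholDerivation, fderiv_zeroExtend
      (f := ContinuousLinearMap.proj (R := ℝ) (φ := fun _ : ι => ℂ) k) fun _ => rfl,
      ContinuousLinearMap.fderiv, wirtingerBar_apply, map_zero]
    rcases eq_or_ne k l with rfl | hkl <;> simp [*]

/-- The component, given by a functional `T` on the cotangent space, of the coefficients of
Hadamard's lemma for `F` at `y`. -/
def hadamardCoeff (hconv : Convex ℝ (B : Set (ι → ℂ))) (y : B) (T : ((ι → ℂ) →L[ℝ] ℂ) →L[ℝ] ℂ)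
    (F : smoothAlgebra B) : smoothAlgebra B :=
  restrictSmooth (fun z => T (segmentAverage y.1 (fderiv ℝ (zeroExtend F)) z))
    (T.contDiff.comp_contDiffOn (contDiffOn_segmentAverage B.isOpen hconv
      ((contDiffOn_infty_iff_fderiv_of_isOpen B.isOpen).mp (contDiffOn_zeroExtend F)).2 y.2))

lemma sub_algebraMap_eq_sum_hadamardCoeff (hconv : Convex ℝ (B : Set (ι → ℂ))) (y : B)
    (F : smoothAlgebra B) :
    F - algebraMap ℂ _ (evalAt y F) =
      ∑ k, (hadamardCoeff hconv y (wirtinger k) F * (coord k - algebraMap ℂ _ (evalAt y (coord k)))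
        + hadamardCoeff hconv y (wirtingerBar k) F *
          (conjCoord k - algebraMap ℂ _ (evalAt y (conjCoord k)))) := smoothAlgebra_ext fun z => by
  have key := apply_segmentAverage_fderiv B.isOpen hconv
    ((contDiffOn_zeroExtend F).of_le (mod_cast le_top)) y.2 z.2
  rw [apply_eq_sum_wirtinger, zeroExtend_apply, zeroExtend_apply] at key
  simp only [map_sub, map_sum, map_add, map_mul, AlgHom.commutes, Algebra.algebraMap_self,
    RingHom.id_apply]
  rw [← key]
  simp only [hadamardCoeff, evalAt_restrictSmooth, evalAt_coord, evalAt_conjCoord, Pi.sub_apply,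
    map_sub, mul_comm]

lemma evalAt_hadamardCoeff_wirtingerBar (hconv : Convex ℝ (B : Set (ι → ℂ))) (y z : B) (l : ι)
    (F : smoothAlgebra B) :
    evalAt z (hadamardCoeff hconv y (wirtingerBar l) F)
      = segmentAverage y.1 (zeroExtend (antiholDerivation l F)) z := by
  have hF' : ContinuousOn (fderiv ℝ (zeroExtend F)) B :=
    (contDiffOn_zeroExtend F).continuousOn_fderiv_of_isOpen B.isOpen (mod_cast le_top)
  have hdBar : Set.EqOn (zeroExtend (antiholDerivation l F))
      (fun z => wirtingerBar l (fderiv ℝ (zeroExtend F) z)) B :=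
    zeroExtend_eqOn (evalAt_antiholDerivation l F)
  rw [segmentAverage_congr hconv hdBar y.2 z.2, segmentAverage_clm_comp _ hconv hF' y.2 z.2]
  rfl

end Hadamard

section PotentialAlgebra

open scoped Matrix

lemma mem_of_forall_mulVec_mem {ι R : Type*} [Fintype ι] [DecidableEq ι] [CommRing R] {I : Ideal R}
    {A : Matrix ι ι R} (hA : IsUnit A.det) {w : ι → R} (h : ∀ k, (A *ᵥ w) k ∈ I) (l : ι) :
    w l ∈ I := by
  rw [← Matrix.one_mulVec w, ← Matrix.nonsing_inv_mul A hA, ← Matrix.mulVec_mulVec]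
  exact I.sum_mem fun k _ => I.mul_mem_left _ (h k)

variable {ι : Type*} [Fintype ι] [DecidableEq ι] {B : Opens (ι → ℂ)}

lemma isUnit_det_of_evalAt {A : Matrix ι ι (smoothAlgebra B)}
    (hA : ∀ z : B, (A.map (evalAt z)).det ≠ 0) : IsUnit A.det :=
  isUnit_of_evalAt_ne_zero fun z => by
    rw [AlgHom.map_det]
    exact hA z

/-- The Kähler algebra of the smooth functions on `B`, with the metric given by the potential
`P`. -/
def potentialAlgebra (P : smoothAlgebra B)
    (hP : IsUnit (Matrix.of fun k l => holDerivation k (antiholDerivation l P)).det) :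
    KahlerAlgebra ℂ ι (smoothAlgebra B) where
  d := holDerivation
  dBar := antiholDerivation
  pot := P
  gInv := (Matrix.of fun k l => holDerivation k (antiholDerivation l P))⁻¹
  d_comm := holDerivation_comm
  dBar_comm := antiholDerivation_comm
  d_dBar := holDerivation_antiholDerivation
  gInv_mul := Matrix.nonsing_inv_mul _ hP

lemma potentialAlgebra_isGeneratedAt {P : smoothAlgebra B}
    (hP : IsUnit (Matrix.of fun k l => holDerivation k (antiholDerivation l P)).det)
    (hconv : Convex ℝ (B : Set (ι → ℂ))) (y : B) (hdet : ∀ z : B, (Matrix.of fun k l =>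
      segmentAverage y.1 (zeroExtend ((potentialAlgebra P hP).g k l)) z).det ≠ 0) :
    (potentialAlgebra P hP).IsGeneratedAt (evalAt y) := by
  intro F hF
  set I := Ideal.span {b | ∃ a δ, (potentialAlgebra P hP).IsGenerator a δ ∧
    b = a - algebraMap ℂ _ (evalAt y a)}
  have hcoord : ∀ k, coord k - algebraMap ℂ _ (evalAt y (coord k)) ∈ I := fun k =>
    Ideal.subset_span ⟨_, _, .holomorphic _ fun l => antiholDerivation_coord l k, rfl⟩
  -- The antiholomorphic part of the Hadamard expansion of `∂_k P` is an averaged metric.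
  have hconj : ∀ l, conjCoord l - algebraMap ℂ _ (evalAt y (conjCoord l)) ∈ I := by
    refine mem_of_forall_mulVec_mem (A := Matrix.of fun k l =>
      hadamardCoeff hconv y (wirtingerBar l) (holDerivation k P)) (isUnit_det_of_evalAt fun z => ?_)
      fun k => ?_
    · convert hdet z using 2
      ext k l
      exact (evalAt_hadamardCoeff_wirtingerBar hconv y z l _).trans
        (by rw [← holDerivation_antiholDerivation]; rfl)
    · have hpot : holDerivation k P - algebraMap ℂ _ (evalAt y (holDerivation k P)) ∈ I :=
        Ideal.subset_span ⟨_, _, .potential k, rfl⟩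
      rw [sub_algebraMap_eq_sum_hadamardCoeff hconv, Finset.sum_add_distrib] at hpot
      exact (I.add_mem_iff_right (I.sum_mem fun i _ => I.mul_mem_left _ (hcoord i))).mp hpot
  rw [← sub_zero F, ← map_zero (algebraMap ℂ (smoothAlgebra B)), ← hF,
    sub_algebraMap_eq_sum_hadamardCoeff hconv]
  exact I.sum_mem fun k _ =>
    I.add_mem (I.mul_mem_left _ (hcoord k)) (I.mul_mem_left _ (hconj k))

end PotentialAlgebra

section Nondegenerate

section WirtingerReal

variable {ι : Type*} [DecidableEq ι]

lemma single_I (k : ι) : (Pi.single k Complex.I : ι → ℂ) = Complex.I • Pi.single k 1 := by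
  rw [← Pi.single_smul, smul_eq_mul, mul_one]

variable [Fintype ι]

lemma eq_zero_of_wirtingerBar_eq_zero {L : (ι → ℂ) →L[ℝ] ℂ}
    (hreal : ∀ v, starRingEnd ℂ (L v) = L v) (hL : ∀ k, wirtingerBar k L = 0) : L = 0 := by
  have hconj : ∀ k, wirtinger k L = starRingEnd ℂ (wirtingerBar k L) := fun k => by
    simp [wirtinger_apply, wirtingerBar_apply, hreal, sub_eq_add_neg, map_ofNat]
  ext1 v
  simp [apply_eq_sum_wirtinger, hconj, hL]

lemma apply_eq_sum_of_map_I_smul {L : (ι → ℂ) →L[ℝ] ℂ}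
    (hL : ∀ v, L (Complex.I • v) = Complex.I * L v) (v : ι → ℂ) :
    L v = ∑ k, v k * L (Pi.single k 1) := by
  rw [apply_eq_sum_wirtinger]
  refine Finset.sum_congr rfl fun k _ => ?_
  rw [wirtinger_apply, wirtingerBar_apply, single_I, hL]
  linear_combination
    (starRingEnd ℂ (v k) - v k) * L (Pi.single k 1) / 2 * Complex.I_sq

lemma det_ne_zero_of_nondegenerate (P : LinearMap.BilinForm ℝ (ι → ℂ))
    (hI : ∀ v w, P (Complex.I • v) (Complex.I • w) = P v w)
    (hnd : ∀ v, (∀ w, P v w = 0) → v = 0) :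
    (Matrix.of fun k l : ι => Complex.I * (1 / 4) *
      ((P (Pi.single k 1) (Pi.single l 1) : ℂ)
        + (P (Pi.single k Complex.I) (Pi.single l Complex.I) : ℂ)
        + Complex.I * ((P (Pi.single k 1) (Pi.single l Complex.I) : ℂ)
          - (P (Pi.single k Complex.I) (Pi.single l 1) : ℂ)))).det ≠ 0 := by
  have hneg : ∀ v w, P (Complex.I • v) w = -P v (Complex.I • w) := fun v w => by
    rw [← hI (Complex.I • v) w, smul_smul, Complex.I_mul_I, neg_one_smul, map_neg,
      LinearMap.neg_apply]
  let L : (ι → ℂ) →L[ℝ] (ι → ℂ) →L[ℝ] ℂ :=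
    (P.compr₂ Complex.ofRealCLM.toLinearMap).toContinuousBilinearMap
  have hL : ∀ v w, L v w = P v w := fun _ _ => rfl
  have hlin : ∀ l v, wirtingerBar l (L (Complex.I • v)) = Complex.I * wirtingerBar l (L v) :=
    fun l v => by
    simp only [wirtingerBar_apply, hL, hneg, single_I, smul_smul, Complex.I_mul_I, neg_one_smul,
      map_neg, Complex.ofReal_neg]
    linear_combination -(P v (Complex.I • Pi.single l 1) / 2 : ℂ) * Complex.I_sq
  intro hdet
  obtain ⟨c, hc0, hc⟩ := Matrix.exists_vecMul_eq_zero_iff.mpr hdet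
  have hker : ∀ l, wirtingerBar l (L c) = 0 := fun l => by
    refine (mul_eq_zero.mp ?_).resolve_left Complex.I_ne_zero
    refine (?_ : _ = Matrix.vecMul c _ l).trans (congrFun hc l)
    rw [← ContinuousLinearMap.comp_apply, apply_eq_sum_of_map_I_smul (hlin l), Finset.mul_sum]
    refine Finset.sum_congr rfl fun k _ => ?_
    simp only [ContinuousLinearMap.comp_apply, wirtingerBar_apply, hL, Matrix.of_apply, single_I,
      hI, hneg, Complex.ofReal_neg]
    ring
  have hLc : L c = 0 := eq_zero_of_wirtingerBar_eq_zero (fun w => Complex.conj_ofReal _) hker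
  exact hc0 (hnd c fun w => Complex.ofReal_eq_zero.mp (DFunLike.congr_fun hLc w))

end WirtingerReal

variable {n : ℕ} {M : Type*} [TopologicalSpace M] [ChartedSpace (Fin n → ℂ) M]

lemma IsHolChart.mdifferentiable {e : OpenPartialHomeomorph M (Fin n → ℂ)}
    (he : IsHolChart e) : e.MDifferentiable 𝓘(ℂ, Fin n → ℂ) 𝓘(ℂ, Fin n → ℂ) :=
  have he1 := IsManifold.maximalAtlas_subset_of_le (m := 1) le_top he
  ⟨fun _ hy => (mdifferentiableAt_of_mem_maximalAtlas he1 hy).mdifferentiableWithinAt,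
    fun _ hy => (mdifferentiableAt_symm_of_mem_maximalAtlas he1 hy).mdifferentiableWithinAt⟩

lemma PseudoKahlerForm.det_g_ne_zero (Ω : PseudoKahlerForm n M)
    {e : OpenPartialHomeomorph M (Fin n → ℂ)} (he : IsHolChart e) {x : M} (hx : x ∈ e.source) :
    (Matrix.of fun k l => Ω.g e k l x).det ≠ 0 := by
  have hinj := he.mdifferentiable.symm.mfderiv_injective (e.map_source hx)
  have hsurj := he.mdifferentiable.symm.mfderiv_surjective (e.map_source hx)
  let L : (Fin n → ℂ) →L[ℂ] (Fin n → ℂ) :=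
    mfderiv 𝓘(ℂ, Fin n → ℂ) 𝓘(ℂ, Fin n → ℂ) e.symm (e x)
  let F : LinearMap.BilinForm ℝ (Fin n → ℂ) := Ω.form (e.symm (e x))
  refine det_ne_zero_of_nondegenerate (F.compl₁₂ (L.restrictScalars ℝ).toLinearMap
    (L.restrictScalars ℝ).toLinearMap) (fun v w => ?_) fun v hv => ?_
  · change F (L (Complex.I • v)) (L (Complex.I • w)) = F (L v) (L w)
    rw [L.map_smul, L.map_smul]
    exact Ω.type_one_one _ _ _
  · refine hinj ((Ω.nondegenerate _ _ fun w => ?_).trans (map_zero L).symm)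
    obtain ⟨w', rfl⟩ := hsurj w
    exact hv w'

end Nondegenerate

section Represents

variable {n : ℕ} {M : Type*} [TopologicalSpace M] {e : OpenPartialHomeomorph M (Fin n → ℂ)}
  {B : Opens (Fin n → ℂ)} {f h : M → ℂ} {F H : smoothAlgebra B}

/-- `F` is the coordinate expression of the function `f` over `B ⊆ e.target`. -/
def Represents (e : OpenPartialHomeomorph M (Fin n → ℂ)) (f : M → ℂ) (F : smoothAlgebra B) : Prop :=
  ∀ z : B, f (e.symm z) = evalAt z F

/-- The points of the chart domain with coordinates in `B`. -/
def chartSet (e : OpenPartialHomeomorph M (Fin n → ℂ)) (B : Opens (Fin n → ℂ)) : Set M :=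
  e.source ∩ e ⁻¹' B

/-- The function on the manifold with a given coordinate expression. -/
def ofCoordinates (e : OpenPartialHomeomorph M (Fin n → ℂ)) (F : smoothAlgebra B) : M → ℂ :=
  zeroExtend F ∘ e

lemma isOpen_chartSet : IsOpen (chartSet e B) := e.isOpen_inter_preimage B.isOpen

lemma chartSet_subset_source : chartSet e B ⊆ e.source := Set.inter_subset_left

lemma symm_mem_chartSet (hB : (B : Set (Fin n → ℂ)) ⊆ e.target) (z : B) :
    e.symm z ∈ chartSet e B :=
  ⟨e.map_target (hB z.2), by rw [Set.mem_preimage, e.right_inv (hB z.2)]; exact z.2⟩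

lemma image_chartSet (hB : (B : Set (Fin n → ℂ)) ⊆ e.target) : e '' chartSet e B = B := by
  refine Set.Subset.antisymm (Set.image_subset_iff.mpr Set.inter_subset_right) fun z hz => ?_
  exact ⟨e.symm z, symm_mem_chartSet hB ⟨z, hz⟩, e.right_inv (hB hz)⟩

lemma del_symm_apply (k : Fin n) (f : M → ℂ) {z : Fin n → ℂ} (hz : z ∈ e.target) :
    del e k f (e.symm z) = wirtinger k (fderiv ℝ (f ∘ e.symm) z) := by
  rw [del, e.right_inv hz, wirtinger_apply]

lemma delBar_symm_apply (k : Fin n) (f : M → ℂ) {z : Fin n → ℂ} (hz : z ∈ e.target) :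
    delBar e k f (e.symm z) = wirtingerBar k (fderiv ℝ (f ∘ e.symm) z) := by
  rw [delBar, e.right_inv hz, wirtingerBar_apply]

lemma represents_ofCoordinates (hB : (B : Set (Fin n → ℂ)) ⊆ e.target) (F : smoothAlgebra B) :
    Represents e (ofCoordinates e F) F := fun z => by
  rw [ofCoordinates, Function.comp_apply, e.right_inv (hB z.2), zeroExtend_apply]

namespace Represents

lemma zero : Represents e 0 (0 : smoothAlgebra B) := fun _ => rfl

lemma add (hf : Represents e f F) (hh : Represents e h H) :
    Represents e (fun x => f x + h x) (F + H) := fun z => by rw [map_add, ← hf, ← hh]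

lemma sub (hf : Represents e f F) (hh : Represents e h H) :
    Represents e (fun x => f x - h x) (F - H) := fun z => by rw [map_sub, ← hf, ← hh]

lemma mul (hf : Represents e f F) (hh : Represents e h H) :
    Represents e (fun x => f x * h x) (F * H) := fun z => by rw [map_mul, ← hf, ← hh]

lemma neg (hf : Represents e f F) : Represents e (fun x => -f x) (-F) := fun z => by
  rw [map_neg, ← hf]

lemma const_mul (hf : Represents e f F) (c : ℂ) : Represents e (fun x => c * f x) (c • F) :=
  fun z => by rw [map_smul, ← hf, smul_eq_mul]

lemma sum {ι : Type*} {s : Finset ι} {f : ι → M → ℂ} {F : ι → smoothAlgebra B}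
    (h : ∀ i, Represents e (f i) (F i)) : Represents e (fun x => ∑ i ∈ s, f i x) (∑ i ∈ s, F i) :=
  fun z => by rw [map_sum]; exact Finset.sum_congr rfl fun i _ => h i z

lemma fderiv_comp_symm (hf : Represents e f F) (z : B) :
    fderiv ℝ (f ∘ e.symm) z = fderiv ℝ (zeroExtend F) z :=
  (fderiv_zeroExtend (fun z => (hf z).symm) z).symm

lemma del (hB : (B : Set (Fin n → ℂ)) ⊆ e.target) (hf : Represents e f F) (k : Fin n) :
    Represents e (del e k f) (holDerivation k F) := fun z => by
  rw [del_symm_apply k f (hB z.2), evalAt_holDerivation, hf.fderiv_comp_symm]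

lemma delBar (hB : (B : Set (Fin n → ℂ)) ⊆ e.target) (hf : Represents e f F) (k : Fin n) :
    Represents e (delBar e k f) (antiholDerivation k F) := fun z => by
  rw [delBar_symm_apply k f (hB z.2), evalAt_antiholDerivation, hf.fderiv_comp_symm]

lemma apply_eq (hf : Represents e f F) {x : M} (hx : x ∈ e.source) (hxB : e x ∈ B) :
    f x = evalAt ⟨e x, hxB⟩ F := by
  rw [← hf ⟨e x, hxB⟩, e.left_inv hx]

lemma eq_of_eqOn (hB : (B : Set (Fin n → ℂ)) ⊆ e.target) (hf : Represents e f F)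
    (hh : Represents e h H) (hfh : Set.EqOn f h (chartSet e B)) : F = H :=
  smoothAlgebra_ext fun z => by rw [← hf, ← hh, hfh (symm_mem_chartSet hB z)]

end Represents

variable [ChartedSpace (Fin n → ℂ) M]

lemma IsHolChart.mem_real_maximalAtlas (he : IsHolChart e) :
    e ∈ IsManifold.maximalAtlas 𝓘(ℝ, Fin n → ℂ) ∞ M :=
  StructureGroupoid.maximalAtlas_mono (groupoid_of_pregroupoid_le _ _ fun _ _ hf =>
    (ContDiffOn.restrict_scalars ℝ hf).of_le le_top) he

lemma smoothOn_iff (he : IsHolChart e) {W : Set M} (hW : W ⊆ e.source) :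
    SmoothOn n f W ↔ ContDiffOn ℝ ∞ (f ∘ e.symm) (e '' W) := by
  have := contMDiffOn_iff_of_mem_maximalAtlas' (f := f) he.mem_real_maximalAtlas
    (IsManifold.chart_mem_maximalAtlas (I := 𝓘(ℝ, ℂ)) (n := ∞) (0 : ℂ)) hW
    (fun _ _ => Set.mem_univ _)
  refine this.trans ?_
  simp [OpenPartialHomeomorph.extend, chartAt_self_eq, Function.comp_def]

lemma exists_represents (he : IsHolChart e) {U : Set M} (hU : U ⊆ e.source)
    (hB : (B : Set (Fin n → ℂ)) ⊆ e '' U) (hf : SmoothOn n f U) :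
    ∃ F : smoothAlgebra B, Represents e f F :=
  ⟨restrictSmooth _ (((smoothOn_iff he hU).mp hf).mono hB), fun _ => rfl⟩

lemma Represents.smoothOn (he : IsHolChart e) (hB : (B : Set (Fin n → ℂ)) ⊆ e.target)
    (hf : Represents e f F) : SmoothOn n f (chartSet e B) := by
  rw [smoothOn_iff he chartSet_subset_source, image_chartSet hB]
  exact (contDiffOn_zeroExtend F).congr (zeroExtend_eqOn fun z => (hf z).symm).symm

lemma holomorphicOn_ofCoordinates (he : IsHolChart e)
    (hF : ∀ l, antiholDerivation l F = 0) : HolomorphicOn n (ofCoordinates e F) (chartSet e B) := by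
  intro x hx
  have hcomplex : DifferentiableAt ℂ (zeroExtend F) (e x) := by
    refine (differentiableAt_iff_restrictScalars ℝ (differentiableAt_zeroExtend F ⟨e x, hx.2⟩)).mpr
      ⟨∑ k, wirtinger k (fderiv ℝ (zeroExtend F) (e x)) •
        ContinuousLinearMap.proj (R := ℂ) (φ := fun _ : Fin n => ℂ) k, ?_⟩
    ext v
    simp [apply_eq_sum_wirtinger (fderiv ℝ (zeroExtend F) (e x)) v, mul_comm,
      ← evalAt_antiholDerivation _ F ⟨e x, hx.2⟩, hF]
  exact (hcomplex.mdifferentiableAt.comp x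
    (he.mdifferentiable.mdifferentiableAt hx.1)).mdifferentiableWithinAt

end Represents

section LocalModel

variable {n : ℕ} {M : Type*} [TopologicalSpace M] [ChartedSpace (Fin n → ℂ) M]
  {Ω : PseudoKahlerForm n M} {e : OpenPartialHomeomorph M (Fin n → ℂ)} {B : Opens (Fin n → ℂ)}

/-- The Kähler algebra `K` is the coordinate expression over `B` of the geometry of `Ω`. -/
structure IsLocalModel (Ω : PseudoKahlerForm n M) (e : OpenPartialHomeomorph M (Fin n → ℂ))
    (K : KahlerAlgebra ℂ (Fin n) (smoothAlgebra B)) : Prop where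
  protected del : ∀ {f F}, Represents e f F → ∀ k, Represents e (del e k f) (K.d k F)
  protected delBar : ∀ {f F}, Represents e f F → ∀ l, Represents e (delBar e l f) (K.dBar l F)
  g : ∀ k l, Represents e (Ω.g e k l) (K.g k l)
  gInv : ∀ l k, Represents e (Ω.gInv e l k) (K.gInv l k)

namespace IsLocalModel

variable {K : KahlerAlgebra ℂ (Fin n) (smoothAlgebra B)} (hK : IsLocalModel Ω e K)
include hK

lemma christoffel (k p s : Fin n) : Represents e (Ω.christoffel e k p s) (K.christoffel k p s) :=
  .sum fun t => (hK.del (hK.g p t) k).mul (hK.gInv t s)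

lemma christoffelBar (l q t : Fin n) :
    Represents e (Ω.christoffelBar e l q t) (K.christoffelBar l q t) :=
  .sum fun s => (hK.gInv t s).mul (hK.delBar (hK.g s q) l)

lemma curvatureUp (l k q p : Fin n) :
    Represents e (Ω.curvatureUp e l k q p) (K.curvatureUp l k q p) :=
  .sum fun a => .sum fun b => ((hK.gInv l a).mul (hK.gInv b k)).mul
    (.sum fun m => (hK.gInv q m).mul (hK.delBar (hK.christoffel a m p) b).neg)

variable {f h : M → ℂ} {F H : smoothAlgebra B}

section Covariant

variable (hf : Represents e f F)
include hf

lemma cov2 (k p : Fin n) : Represents e (Ω.cov2 e f k p) (K.cov2 F k p) :=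
  (hK.del (hK.del hf k) p).sub (.sum fun m => (hK.christoffel p k m).mul (hK.del hf m))

lemma covBar2 (l q : Fin n) : Represents e (Ω.covBar2 e f l q) (K.covBar2 F l q) :=
  (hK.delBar (hK.delBar hf l) q).sub
    (.sum fun m => (hK.christoffelBar q l m).mul (hK.delBar hf m))

lemma cov3 (k p s : Fin n) : Represents e (Ω.cov3 e f k p s) (K.cov3 F k p s) :=
  ((hK.del (hK.cov2 hf k p) s).sub (.sum fun m => (hK.christoffel s k m).mul (hK.cov2 hf m p))).sub
    (.sum fun m => (hK.christoffel s p m).mul (hK.cov2 hf k m))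

lemma covBar3 (l q t : Fin n) : Represents e (Ω.covBar3 e f l q t) (K.covBar3 F l q t) :=
  ((hK.delBar (hK.covBar2 hf l q) t).sub
    (.sum fun m => (hK.christoffelBar t l m).mul (hK.covBar2 hf m q))).sub
    (.sum fun m => (hK.christoffelBar t q m).mul (hK.covBar2 hf l m))

end Covariant

section Pairings

variable (hf : Represents e f F) (hh : Represents e h H)
include hf hh

lemma pairing1 : Represents e
    (fun x => ∑ l, ∑ k, Ω.gInv e l k x * delBar e l f x * del e k h x)
    (K.pairing1 F H) := by
  rw [K.pairing1_eq_sum]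
  exact .sum fun l => .sum fun k => ((hK.gInv l k).mul (hK.delBar hf l)).mul (hK.del hh k)

lemma pairing2 : Represents e
    (fun x => ∑ l, ∑ k, ∑ q, ∑ p,
      Ω.gInv e l k x * Ω.gInv e q p x * Ω.covBar2 e f l q x * Ω.cov2 e h k p x)
    (K.pairing2 F H) := by
  rw [K.pairing2_eq_sum]
  exact .sum fun l => .sum fun k => .sum fun q => .sum fun p =>
    (((hK.gInv l k).mul (hK.gInv q p)).mul (hK.covBar2 hf l q)).mul (hK.cov2 hh k p)

lemma pairing2_coordinates : Represents e
    (fun x => ∑ l, ∑ k, ∑ q, ∑ p,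
      (Ω.gInv e q p x * Ω.gInv e l k x *
          delBar e l (delBar e q f) x * del e k (del e p h) x
        + Ω.gInv e q p x * del e p (Ω.gInv e l k) x *
          delBar e l (delBar e q f) x * del e k h x
        + delBar e l (Ω.gInv e q p) x * Ω.gInv e l k x *
          delBar e q f x * del e k (del e p h) x
        + delBar e l (Ω.gInv e q p) x * del e p (Ω.gInv e l k) x *
          delBar e q f x * del e k h x))
    (K.pairing2 F H) := by
  rw [K.pairing2_eq_sum_coordinates]
  refine .sum fun l => .sum fun k => .sum fun q => .sum fun p => ?_
  have hlq := hK.delBar (hK.delBar hf q) l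
  have hkp := hK.del (hK.del hh p) k
  have hdel := hK.del (hK.gInv l k) p
  have hdelBar := hK.delBar (hK.gInv q p) l
  exact ((((((hK.gInv q p).mul (hK.gInv l k)).mul hlq).mul hkp).add
    ((((hK.gInv q p).mul hdel).mul hlq).mul (hK.del hh k))).add
    (((hdelBar.mul (hK.gInv l k)).mul (hK.delBar hf q)).mul hkp)).add
    (((hdelBar.mul hdel).mul (hK.delBar hf q)).mul (hK.del hh k))

lemma pairing3 : Represents e
    (fun x => ∑ l, ∑ k, ∑ q, ∑ p, ∑ t, ∑ s,
      Ω.gInv e l k x * Ω.gInv e q p x * Ω.gInv e t s x *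
        Ω.covBar3 e f l q t x * Ω.cov3 e h k p s x)
    (K.pairing3 F H) := by
  rw [K.pairing3_eq_sum]
  exact .sum fun l => .sum fun k => .sum fun q => .sum fun p => .sum fun t => .sum fun s =>
    ((((hK.gInv l k).mul (hK.gInv q p)).mul (hK.gInv t s)).mul (hK.covBar3 hf l q t)).mul
      (hK.cov3 hh k p s)

lemma curvaturePairing : Represents e
    (fun x => ∑ l, ∑ k, ∑ q, ∑ p,
      Ω.curvatureUp e l k q p x * Ω.covBar2 e f l q x * Ω.cov2 e h k p x)
    (K.curvaturePairing F H) := by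
  rw [K.curvaturePairing_eq_sum]
  exact .sum fun l => .sum fun k => .sum fun q => .sum fun p =>
    ((hK.curvatureUp l k q p).mul (hK.covBar2 hf l q)).mul (hK.cov2 hh k p)

end Pairings

end IsLocalModel

section Potential

variable (hB : (B : Set (Fin n → ℂ)) ⊆ e.target) {Φ : M → ℝ} (hΦ : Ω.IsPotential e Φ)
  {P : smoothAlgebra B} (hP : Represents e (fun x => (Φ x : ℂ)) P)
include hB hΦ hP

lemma represents_g_of_isPotential (k l : Fin n) :
    Represents e (Ω.g e k l) (holDerivation k (antiholDerivation l P)) := fun z => by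
  rw [hΦ.2 _ (e.map_target (hB z.2)), ((hP.delBar hB l).del hB k) z]

lemma isUnit_det_of_isPotential (he : IsHolChart e) :
    IsUnit (Matrix.of fun k l => holDerivation k (antiholDerivation l P)).det :=
  isUnit_det_of_evalAt fun z => by
    have hg : (Matrix.of fun k l => holDerivation k (antiholDerivation l P)).map (evalAt z)
        = Matrix.of fun k l => Ω.g e k l (e.symm z) :=
      Matrix.ext fun k l => (represents_g_of_isPotential hB hΦ hP k l z).symm
    rw [hg]
    exact Ω.det_g_ne_zero he (e.map_target (hB z.2))

lemma isLocalModel_potentialAlgebra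
    (hunit : IsUnit (Matrix.of fun k l => holDerivation k (antiholDerivation l P)).det) :
    IsLocalModel Ω e (potentialAlgebra P hunit) where
  del hf := hf.del hB
  delBar hf := hf.delBar hB
  g := represents_g_of_isPotential hB hΦ hP
  gInv l k z := by
    have hinv : (potentialAlgebra P hunit).gInv.map (evalAt z) *
        Matrix.of (fun k l => Ω.g e k l (e.symm z)) = 1 := by
      have hg : Matrix.of (fun k l => Ω.g e k l (e.symm z))
          = (potentialAlgebra P hunit).g.map (evalAt z) :=
        Matrix.ext fun k l => represents_g_of_isPotential hB hΦ hP k l z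
      rw [hg, ← Matrix.map_mul, KahlerAlgebra.gInv_mul_g,
        Matrix.map_one _ (map_zero _) (map_one _)]
    rw [PseudoKahlerForm.gInv, Matrix.inv_eq_left_inv hinv, Matrix.map_apply]

end Potential

end LocalModel

section Bidifferential

variable {n : ℕ} {B B' : Opens (Fin n → ℂ)}

/-- Iterated derivatives along a word of holomorphic (`inl k`) and antiholomorphic (`inr l`)
indices, as in `iterDel`. -/
def iterDerivation : List (Fin n ⊕ Fin n) → smoothAlgebra B →ₗ[ℂ] smoothAlgebra B
  | [] => LinearMap.id
  | Sum.inl k :: w => (holDerivation (B := B) k).toLinearMap ∘ₗ iterDerivation w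
  | Sum.inr l :: w => (antiholDerivation (B := B) l).toLinearMap ∘ₗ iterDerivation w

/-- The restriction of smooth functions to a smaller open set. -/
def restrictOpens (h : B' ≤ B) : smoothAlgebra B →ₗ[ℂ] smoothAlgebra B' where
  toFun F := restrictSmooth (zeroExtend F) ((contDiffOn_zeroExtend F).mono h)
  map_add' F H := smoothAlgebra_ext fun z => by
    simp only [map_add, evalAt_restrictSmooth, zeroExtend_apply _ (⟨z, h z.2⟩ : B)]
  map_smul' c F := smoothAlgebra_ext fun z => by
    simp only [map_smul, RingHom.id_apply, evalAt_restrictSmooth,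
      zeroExtend_apply _ (⟨z, h z.2⟩ : B)]

variable {M : Type*} [TopologicalSpace M] {e : OpenPartialHomeomorph M (Fin n → ℂ)}

lemma Represents.restrictOpens {f : M → ℂ} {F : smoothAlgebra B} (hf : Represents e f F)
    (h : B' ≤ B) : Represents e f (restrictOpens h F) := fun z =>
  (hf ⟨z, h z.2⟩).trans (zeroExtend_apply F ⟨z, h z.2⟩).symm

lemma Represents.iterDel {f : M → ℂ} {F : smoothAlgebra B}
    (hB : (B : Set (Fin n → ℂ)) ⊆ e.target) (hf : Represents e f F) :
    ∀ w, Represents e (iterDel e w f) (iterDerivation w F)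
  | [] => hf
  | Sum.inl k :: w => (hf.iterDel hB w).del hB k
  | Sum.inr l :: w => (hf.iterDel hB w).delBar hB l

variable [ChartedSpace (Fin n → ℂ) M] {C : (M → ℂ) → (M → ℂ) → (M → ℂ)}

namespace IsBidifferential

variable (hC : IsBidifferential (n := n) C) (he : IsHolChart e)
  (hB : (B : Set (Fin n → ℂ)) ⊆ e.target)
include hC he hB

lemma exists_local_bilin (z : B) :
    ∃ B' ≤ B, z.1 ∈ B' ∧ ∃ P : smoothAlgebra B →ₗ[ℂ] smoothAlgebra B →ₗ[ℂ] smoothAlgebra B',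
      ∀ {f h F H}, Represents e f F → Represents e h H → Represents e (C f h) (P F H) := by
  obtain ⟨V, hV, hzV, -, S, c, hc, hS⟩ := hC e he (e.symm z) (e.map_target (hB z.2))
  let B' : Opens (Fin n → ℂ) := B ⊓ ⟨e.target ∩ e.symm ⁻¹' V, e.isOpen_inter_preimage_symm hV⟩
  have hB' : (B' : Set (Fin n → ℂ)) ⊆ e.target := fun y hy => hB hy.1
  have hsub : chartSet e B' ⊆ V := fun y hy => by
    simpa only [Set.mem_preimage, e.left_inv hy.1] using hy.2.2.2
  choose! A hA using fun p hp => exists_represents he chartSet_subset_source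
    (image_chartSet hB').ge ((hc p hp).mono hsub)
  let D (w : List (Fin n ⊕ Fin n)) : smoothAlgebra B →ₗ[ℂ] smoothAlgebra B' :=
    iterDerivation w ∘ₗ restrictOpens inf_le_left
  refine ⟨B', inf_le_left, ⟨z.2, hB z.2, hzV⟩, ∑ p ∈ S,
    (LinearMap.mul ℂ _).compl₁₂ (LinearMap.mulLeft ℂ (A p) ∘ₗ D p.1) (D p.2),
    fun {f h F H} hf hh y => ?_⟩
  have hf' := hf.restrictOpens (B' := B') inf_le_left
  have hh' := hh.restrictOpens (B' := B') inf_le_left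
  rw [hS _ f h isOpen_chartSet hsub (hf'.smoothOn he hB') (hh'.smoothOn he hB') _
    (symm_mem_chartSet hB' y)]
  simp only [LinearMap.sum_apply, map_sum, LinearMap.compl₁₂_apply, LinearMap.comp_apply,
    LinearMap.mulLeft_apply, LinearMap.mul_apply', map_mul, D]
  exact Finset.sum_congr rfl fun p hp => by
    rw [hA p hp y, hf'.iterDel hB' p.1 y, hh'.iterDel hB' p.2 y]

lemma exists_bilin_apply (z : B) : ∃ b : smoothAlgebra B →ₗ[ℂ] smoothAlgebra B →ₗ[ℂ] ℂ,
    ∀ {f h F H}, Represents e f F → Represents e h H → C f h (e.symm z) = b F H := by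
  obtain ⟨B', -, hzB', P, hP⟩ := hC.exists_local_bilin he hB z
  exact ⟨P.compr₂ (evalAt (⟨z, hzB'⟩ : B')).toLinearMap, fun hf hh => hP hf hh ⟨z, hzB'⟩⟩

lemma smoothOn {f h : M → ℂ} {F H : smoothAlgebra B} (hf : Represents e f F)
    (hh : Represents e h H) : SmoothOn n (C f h) (chartSet e B) := by
  refine contMDiffOn_of_locally_contMDiffOn fun x hx => ?_
  obtain ⟨B', hB'B, hxB', P, hP⟩ := hC.exists_local_bilin he hB ⟨e x, hx.2⟩
  exact ⟨chartSet e B', isOpen_chartSet, ⟨hx.1, hxB'⟩,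
    ((hP hf hh).smoothOn he fun _ hy => hB (hB'B hy)).mono Set.inter_subset_right⟩

lemma exists_bilin : ∃ c : smoothAlgebra B →ₗ[ℂ] smoothAlgebra B →ₗ[ℂ] smoothAlgebra B,
    ∀ {f h F H}, Represents e f F → Represents e h H → Represents e (C f h) (c F H) := by
  choose b hb using hC.exists_bilin_apply he hB
  have hexists : ∀ F H : smoothAlgebra B, ∃ E : smoothAlgebra B, ∀ z, evalAt z E = b z F H := by
    intro F H
    have hF := represents_ofCoordinates hB F
    have hH := represents_ofCoordinates hB H
    obtain ⟨E, hE⟩ := exists_represents he chartSet_subset_source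
      (image_chartSet hB).ge (hC.smoothOn he hB hF hH)
    exact ⟨E, fun z => by rw [← hE z, hb z hF hH]⟩
  choose c hc using hexists
  refine ⟨LinearMap.mk₂ ℂ c ?_ ?_ ?_ ?_, fun hf hh z => (hb z hf hh).trans (hc _ _ z).symm⟩ <;>
    exact fun _ _ _ => smoothAlgebra_ext fun z => by simp [hc]

end IsBidifferential

end Bidifferential

section SeriesProduct

open Finset.HasAntidiagonal (antidiagonal)

variable {𝕜 A : Type*} [CommSemiring 𝕜] [Semiring A] [Module 𝕜 A] (c : ℕ → A →ₗ[𝕜] A →ₗ[𝕜] A)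

/-- The product of formal series with coefficients in `A` with `F * H = ∑_r ν^r c_r(F, H)` on `A`;
compare `star`. -/
def seriesProduct (F H : PowerSeries A) : PowerSeries A :=
  PowerSeries.mk fun N => ∑ a ∈ antidiagonal N, ∑ b ∈ antidiagonal a.2,
    c a.1 (PowerSeries.coeff b.1 F) (PowerSeries.coeff b.2 H)

lemma coeff_seriesProduct_C_left (F : A) (H : PowerSeries A) (N : ℕ) :
    PowerSeries.coeff N (seriesProduct c (PowerSeries.C F) H) =
      ∑ a ∈ antidiagonal N, c a.1 F (PowerSeries.coeff a.2 H) := by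
  rw [seriesProduct, PowerSeries.coeff_mk]
  refine Finset.sum_congr rfl fun a _ => ?_
  rw [Finset.sum_eq_single (0, a.2)]
  · rw [PowerSeries.coeff_zero_C]
  · rintro ⟨i, j⟩ hij hne
    have hi : i ≠ 0 := by
      rintro rfl
      exact hne (by simpa using hij)
    rw [PowerSeries.coeff_C, if_neg hi, map_zero, LinearMap.zero_apply]
  · simp

lemma coeff_seriesProduct_C_right (F : PowerSeries A) (H : A) (N : ℕ) :
    PowerSeries.coeff N (seriesProduct c F (PowerSeries.C H)) =
      ∑ a ∈ antidiagonal N, c a.1 (PowerSeries.coeff a.2 F) H := by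
  rw [seriesProduct, PowerSeries.coeff_mk]
  refine Finset.sum_congr rfl fun a _ => ?_
  rw [Finset.sum_eq_single (a.2, 0)]
  · rw [PowerSeries.coeff_zero_C]
  · rintro ⟨i, j⟩ hij hne
    have hj : j ≠ 0 := by
      rintro rfl
      exact hne (by simpa using hij)
    rw [PowerSeries.coeff_C, if_neg hj, map_zero]
  · simp

lemma coeff_seriesProduct_C_C (F H : A) (N : ℕ) :
    PowerSeries.coeff N (seriesProduct c (PowerSeries.C F) (PowerSeries.C H)) = c N F H := by
  rw [coeff_seriesProduct_C_left, Finset.sum_eq_single (N, 0)]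
  · rw [PowerSeries.coeff_zero_C]
  · rintro ⟨i, j⟩ hij hne
    have hj : j ≠ 0 := by
      rintro rfl
      exact hne (by simpa using hij)
    rw [PowerSeries.coeff_C, if_neg hj, map_zero]
  · simp

end SeriesProduct

section LocalStar

variable {n : ℕ} {M : Type*} [TopologicalSpace M] {e : OpenPartialHomeomorph M (Fin n → ℂ)}
  {B : Opens (Fin n → ℂ)}

/-- The coefficients of `F` are the coordinate expressions over `B` of the coefficients of `P`. -/
def RepresentsSeries (e : OpenPartialHomeomorph M (Fin n → ℂ)) (P : PowerSeries (M → ℂ))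
    (F : PowerSeries (smoothAlgebra B)) : Prop :=
  ∀ r, Represents e (PowerSeries.coeff r P) (PowerSeries.coeff r F)

/-- The bilinear maps `c r` are the coordinate expressions over `B` of the operators `C r`. -/
def RepresentsStar (e : OpenPartialHomeomorph M (Fin n → ℂ))
    (C : ℕ → (M → ℂ) → (M → ℂ) → (M → ℂ))
    (c : ℕ → smoothAlgebra B →ₗ[ℂ] smoothAlgebra B →ₗ[ℂ] smoothAlgebra B) : Prop :=
  ∀ r {f h F H}, Represents e f F → Represents e h H → Represents e (C r f h) (c r F H)

variable {P Q : PowerSeries (M → ℂ)} {F G : PowerSeries (smoothAlgebra B)}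

namespace RepresentsSeries

lemma eq_of_seriesEqOn (hB : (B : Set (Fin n → ℂ)) ⊆ e.target) (hP : RepresentsSeries e P F)
    (hQ : RepresentsSeries e Q G) (h : SeriesEqOn P Q (chartSet e B)) : F = G :=
  PowerSeries.ext fun r => (hP r).eq_of_eqOn hB (hQ r) (h r)

lemma add (hP : RepresentsSeries e P F) (hQ : RepresentsSeries e Q G) :
    RepresentsSeries e (P + Q) (F + G) := fun r => by
  rw [map_add, map_add]
  exact (hP r).add (hQ r)

lemma X_mul (hP : RepresentsSeries e P F) :
    RepresentsSeries e (PowerSeries.X * P) (PowerSeries.X * F)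
  | 0 => by
    rw [PowerSeries.coeff_zero_X_mul, PowerSeries.coeff_zero_X_mul]
    exact .zero
  | r + 1 => by
    rw [PowerSeries.coeff_succ_X_mul, PowerSeries.coeff_succ_X_mul]
    exact hP r

lemma smoothSeriesOn [ChartedSpace (Fin n → ℂ) M] (he : IsHolChart e)
    (hB : (B : Set (Fin n → ℂ)) ⊆ e.target) (hP : RepresentsSeries e P F) :
    SmoothSeriesOn n P (chartSet e B) := fun r => (hP r).smoothOn he hB

end RepresentsSeries

lemma Represents.C {f : M → ℂ} {F : smoothAlgebra B} (hf : Represents e f F) :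
    RepresentsSeries e (PowerSeries.C f) (PowerSeries.C F) := fun r => by
  rw [PowerSeries.coeff_C, PowerSeries.coeff_C]
  split_ifs
  exacts [hf, .zero]

variable {C : ℕ → (M → ℂ) → (M → ℂ) → (M → ℂ)}
  {c : ℕ → smoothAlgebra B →ₗ[ℂ] smoothAlgebra B →ₗ[ℂ] smoothAlgebra B}

lemma RepresentsStar.star (hc : RepresentsStar e C c) (hP : RepresentsSeries e P F)
    (hQ : RepresentsSeries e Q G) : RepresentsSeries e (star C P Q) (seriesProduct c F G) :=
  fun N z => by
  simp only [KahlerStar.star, seriesProduct, PowerSeries.coeff_mk, Finset.sum_apply, map_sum]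
  exact Finset.sum_congr rfl fun a _ => Finset.sum_congr rfl fun b _ =>
    hc a.1 (hP b.1) (hQ b.2) z

lemma contractibleSpace_chartSet (hB : (B : Set (Fin n → ℂ)) ⊆ e.target)
    (hconv : Convex ℝ (B : Set (Fin n → ℂ))) (hne : (B : Set (Fin n → ℂ)).Nonempty) :
    ContractibleSpace (chartSet e B) :=
  have : ContractibleSpace (B : Set (Fin n → ℂ)) := hconv.contractibleSpace hne
  (e.homeomorphOfImageSubsetSource chartSet_subset_source (image_chartSet hB)).contractibleSpace

variable [ChartedSpace (Fin n → ℂ) M] {Ω : PseudoKahlerForm n M} {Φ : M → ℝ}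

lemma IsBidifferential.exists_representsStar (hC : ∀ r, IsBidifferential (n := n) (C r))
    (he : IsHolChart e) (hB : (B : Set (Fin n → ℂ)) ⊆ e.target) :
    ∃ c : ℕ → smoothAlgebra B →ₗ[ℂ] smoothAlgebra B →ₗ[ℂ] smoothAlgebra B,
      RepresentsStar e C c := by
  choose c hc using fun r => (hC r).exists_bilin he hB
  exact ⟨c, hc⟩

lemma IsStandard.seriesEqOn_del_potential (hC : IsStandard Ω C) (he : IsHolChart e)
    (hΦ : Ω.IsPotential e Φ) (hB : (B : Set (Fin n → ℂ)) ⊆ e.target)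
    (hconv : Convex ℝ (B : Set (Fin n → ℂ))) (hne : (B : Set (Fin n → ℂ)).Nonempty) (k : Fin n)
    {f : M → ℂ} (hf : SmoothOn n f (chartSet e B)) :
    SeriesEqOn (KahlerStar.star C (PowerSeries.C (del e k fun x => (Φ x : ℂ))) (PowerSeries.C f))
      (PowerSeries.C ((del e k fun x => (Φ x : ℂ)) * f) +
        PowerSeries.X * PowerSeries.C (del e k f)) (chartSet e B) := by
  have hsource : (e.restr (chartSet e B)).source = chartSet e B := by
    rw [e.restr_source, isOpen_chartSet.interior_eq, Set.inter_eq_right]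
    exact chartSet_subset_source
  have hcontr : ContractibleSpace (e.restr (chartSet e B)).source := by
    rw [hsource]
    exact contractibleSpace_chartSet hB hconv hne
  have hpot : Ω.IsPotential (e.restr (chartSet e B)) Φ :=
    ⟨hΦ.1.mono (e.restr_source _ ▸ Set.inter_subset_left), fun x hx =>
      hΦ.2 x (e.restr_source _ ▸ hx).1⟩
  have hstar := hC.left_potential (e.restr (chartSet e B))
    (restr_mem_maximalAtlas _ he isOpen_chartSet) hcontr Φ hpot k f (hsource.symm ▸ hf)
  rwa [hsource] at hstar

variable {p : smoothAlgebra B}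
  {hp : IsUnit (Matrix.of fun k l => holDerivation k (antiholDerivation l p)).det}
  (hc : RepresentsStar e C c) (hC : IsStandard Ω C) (he : IsHolChart e) (hΦ : Ω.IsPotential e Φ)
  (hB : (B : Set (Fin n → ℂ)) ⊆ e.target) (hconv : Convex ℝ (B : Set (Fin n → ℂ)))
  (hne : (B : Set (Fin n → ℂ)).Nonempty) (hΦp : Represents e (fun x => (Φ x : ℂ)) p)
include hc hC he hΦ hB hconv hne hΦp

lemma RepresentsStar.seriesProduct_generator {a : smoothAlgebra B}
    {δ : Derivation ℂ (smoothAlgebra B) (smoothAlgebra B)}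
    (haδ : (potentialAlgebra p hp).IsGenerator a δ) (h : smoothAlgebra B) :
    seriesProduct c (PowerSeries.C a) (PowerSeries.C h) =
      PowerSeries.C (a * h) + PowerSeries.X * PowerSeries.C (δ h) := by
  have hh := represents_ofCoordinates hB h
  have hhs := hh.smoothOn he hB
  cases haδ with
  | holomorphic a ha =>
    have har := represents_ofCoordinates hB a
    rw [Derivation.zero_apply, map_zero, mul_zero, add_zero]
    exact (hc.star har.C hh.C).eq_of_seriesEqOn hB (har.mul hh).C
      (hC.left_holomorphic _ _ _ isOpen_chartSet (holomorphicOn_ofCoordinates he ha) hhs)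
  | potential k =>
    have har := hΦp.del hB k
    exact (hc.star har.C hh.C).eq_of_seriesEqOn hB ((har.mul hh).C.add (hh.del hB k).C.X_mul)
      (hC.seriesEqOn_del_potential he hΦ hB hconv hne k hhs)

lemma RepresentsStar.isStandardStar :
    (potentialAlgebra p hp).IsStandardStar fun r F H => c r F H where
  add_left r F F' H := by rw [map_add, LinearMap.add_apply]
  zeroth F H := by
    have hF := represents_ofCoordinates hB F
    have hH := represents_ofCoordinates hB H
    exact (hc 0 hF hH).eq_of_eqOn hB (hF.mul hH)
      (hC.zeroth _ _ _ isOpen_chartSet (hF.smoothOn he hB) (hH.smoothOn he hB))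
  assoc r F F' H := by
    have hF := (represents_ofCoordinates hB F).C
    have hF' := (represents_ofCoordinates hB F').C
    have hH := (represents_ofCoordinates hB H).C
    have hassoc := (hc.star (hc.star hF hF') hH).eq_of_seriesEqOn hB
      (hc.star hF (hc.star hF' hH)) (hC.assoc _ _ _ _ isOpen_chartSet
        (hF.smoothSeriesOn he hB) (hF'.smoothSeriesOn he hB) (hH.smoothSeriesOn he hB))
    have hcoeff := congrArg (PowerSeries.coeff r) hassoc
    rw [coeff_seriesProduct_C_right, coeff_seriesProduct_C_left] at hcoeff
    simpa only [coeff_seriesProduct_C_C] using hcoeff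
  generator_one a δ haδ h := by
    rw [← coeff_seriesProduct_C_C, hc.seriesProduct_generator hC he hΦ hB hconv hne hΦp haδ]
    simp [PowerSeries.coeff_C, PowerSeries.coeff_succ_X_mul 0]
  generator_add_two a δ haδ r h := by
    rw [← coeff_seriesProduct_C_C, hc.seriesProduct_generator hC he hΦ hB hconv hne hΦp haδ]
    simp [PowerSeries.coeff_succ_X_mul (r + 1)]

end LocalStar

section Standard

variable {n : ℕ} {M : Type*} [TopologicalSpace M] [ChartedSpace (Fin n → ℂ) M]
  {Ω : PseudoKahlerForm n M} {e : OpenPartialHomeomorph M (Fin n → ℂ)}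

lemma IsLocalModel.isGeneratedAt {B : Opens (Fin n → ℂ)} {P : smoothAlgebra B}
    {hP : IsUnit (Matrix.of fun k l => holDerivation k (antiholDerivation l P)).det}
    (hK : IsLocalModel Ω e (potentialAlgebra P hP)) (hconv : Convex ℝ (B : Set (Fin n → ℂ)))
    (y : B) (hdet : ∀ z ∈ B,
      (Matrix.of fun k l => segmentAverage y.1 (Ω.g e k l ∘ e.symm) z).det ≠ 0) :
    (potentialAlgebra P hP).IsGeneratedAt (evalAt y) := by
  refine potentialAlgebra_isGeneratedAt hP hconv y fun z => ?_
  have haverage : (fun k l => segmentAverage y.1 (zeroExtend ((potentialAlgebra P hP).g k l)) z) =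
      fun k l => segmentAverage y.1 (Ω.g e k l ∘ e.symm) z := funext₂ fun k l =>
    segmentAverage_congr hconv (zeroExtend_eqOn fun w => (hK.g k l w).symm) y.2 z.2
  rw [haverage]
  exact hdet z z.2

lemma PseudoKahlerForm.exists_opens_det_segmentAverage_ne_zero (Ω : PseudoKahlerForm n M)
    (he : IsHolChart e) {U : Set M} (hU : IsOpen U) (hUe : U ⊆ e.source) {x : M} (hx : x ∈ U) :
    ∃ B : Opens (Fin n → ℂ), e x ∈ B ∧ Convex ℝ (B : Set (Fin n → ℂ)) ∧
      (B : Set (Fin n → ℂ)) ⊆ e '' U ∧ ∀ y ∈ B, ∀ z ∈ B,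
        (Matrix.of fun k l => segmentAverage y (Ω.g e k l ∘ e.symm) z).det ≠ 0 := by
  obtain ⟨r, hr, hrU, hdet⟩ := exists_ball_det_segmentAverage_ne_zero
    (G := fun k l => Ω.g e k l ∘ e.symm) (e.isOpen_image_of_subset_source hU hUe)
    (Set.mem_image_of_mem e hx)
    (fun k l => ((smoothOn_iff he hUe).mp ((Ω.smooth e he k l).mono hUe)).continuousOn)
    (by simpa only [Function.comp_apply, e.left_inv (hUe hx)] using Ω.det_g_ne_zero he (hUe hx))
  exact ⟨⟨Metric.ball (e x) r, Metric.isOpen_ball⟩, Metric.mem_ball_self hr, convex_ball _ _,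
    hrU, hdet⟩

lemma IsStandard.exists_localModel {C : ℕ → (M → ℂ) → (M → ℂ) → (M → ℂ)}
    (hC : IsStandard Ω C) (he : IsHolChart e) {Φ : M → ℝ} (hΦ : Ω.IsPotential e Φ)
    {U : Set M} (hU : IsOpen U) (hUe : U ⊆ e.source) {x : M} (hx : x ∈ U) :
    ∃ (B : Opens (Fin n → ℂ)) (K : KahlerAlgebra ℂ (Fin n) (smoothAlgebra B))
      (c : ℕ → smoothAlgebra B →ₗ[ℂ] smoothAlgebra B →ₗ[ℂ] smoothAlgebra B),
      e x ∈ B ∧ (B : Set (Fin n → ℂ)) ⊆ e '' U ∧ IsLocalModel Ω e K ∧ RepresentsStar e C c ∧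
        K.IsStandardStar (fun r F H => c r F H) ∧ ∀ y : B, K.IsGeneratedAt (evalAt y) := by
  obtain ⟨B, hxB, hconv, hBU, hdet⟩ := Ω.exists_opens_det_segmentAverage_ne_zero he hU hUe hx
  have hB : (B : Set (Fin n → ℂ)) ⊆ e.target := hBU.trans (e.mapsTo.mono_left hUe).image_subset
  obtain ⟨P, hP⟩ := exists_represents he subset_rfl (hB.trans e.image_source_eq_target.ge) hΦ.1
  obtain ⟨c, hc⟩ := IsBidifferential.exists_representsStar hC.bidifferential he hB
  have hK := isLocalModel_potentialAlgebra hB hΦ hP (isUnit_det_of_isPotential hB hΦ hP he)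
  exact ⟨B, _, c, hxB, hBU, hK, hc, hc.isStandardStar hC he hΦ hB hconv ⟨e x, hxB⟩ hP,
    fun y => hK.isGeneratedAt hconv y fun z hz => hdet y y.2 z hz⟩

end Standard

end

end KahlerStar

open KahlerStar in
theorem mainTheorem1 {n : ℕ} {M : Type*} [TopologicalSpace M] [ChartedSpace (Fin n → ℂ) M]
    [IsManifold 𝓘(ℂ, Fin n → ℂ) ω M] (Ω : PseudoKahlerForm n M)
    (C : ℕ → (M → ℂ) → (M → ℂ) → (M → ℂ)) (hC : IsStandard Ω C)
    (e : OpenPartialHomeomorph M (Fin n → ℂ)) (he : IsHolChart e)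
    (Φ : M → ℝ) (hΦ : Ω.IsPotential e Φ)
    (U : Set M) (hU : IsOpen U) (hUe : U ⊆ e.source)
    (φ ψ : M → ℂ) (hφ : SmoothOn n φ U) (hψ : SmoothOn n ψ U) (x : M) (hx : x ∈ U) :
    C 1 φ ψ x = ∑ l, ∑ k, Ω.gInv e l k x * delBar e l φ x * del e k ψ x ∧
    C 2 φ ψ x = 1 / 2 * ∑ l, ∑ k, ∑ q, ∑ p,
      (Ω.gInv e q p x * Ω.gInv e l k x *
          delBar e l (delBar e q φ) x * del e k (del e p ψ) x
        + Ω.gInv e q p x * del e p (Ω.gInv e l k) x *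
          delBar e l (delBar e q φ) x * del e k ψ x
        + delBar e l (Ω.gInv e q p) x * Ω.gInv e l k x *
          delBar e q φ x * del e k (del e p ψ) x
        + delBar e l (Ω.gInv e q p) x * del e p (Ω.gInv e l k) x *
          delBar e q φ x * del e k ψ x) ∧
    C 2 φ ψ x = 1 / 2 * ∑ l, ∑ k, ∑ q, ∑ p,
      Ω.gInv e l k x * Ω.gInv e q p x * Ω.covBar2 e φ l q x * Ω.cov2 e ψ k p x ∧
    C 3 φ ψ x =
      1 / 6 * ∑ l, ∑ k, ∑ q, ∑ p, ∑ t, ∑ s,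
        Ω.gInv e l k x * Ω.gInv e q p x * Ω.gInv e t s x *
          Ω.covBar3 e φ l q t x * Ω.cov3 e ψ k p s x
      + 1 / 4 * ∑ l, ∑ k, ∑ q, ∑ p,
        Ω.curvatureUp e l k q p x * Ω.covBar2 e φ l q x * Ω.cov2 e ψ k p x := by
  obtain ⟨B, K, c, hxB, hBU, hK, hCc, hc, hgen⟩ := hC.exists_localModel he hΦ hU hUe hx
  obtain ⟨F, hF⟩ := exists_represents he hUe hBU hφ
  obtain ⟨H, hH⟩ := exists_represents he hUe hBU hψ
  have hC_apply : ∀ r, C r φ ψ x = evalAt ⟨e x, hxB⟩ (c r F H) := fun r =>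
    (hCc r hF hH).apply_eq (hUe hx) hxB
  have hext : ∀ G : smoothAlgebra B, (∀ y, evalAt y G = 0) → G = 0 := fun G hG =>
    smoothAlgebra_ext fun y => by rw [hG, map_zero]
  refine ⟨?_, ?_, ?_, ?_⟩
  · rw [hC_apply, hc.coeff_one_eq hgen hext]
    exact ((hK.pairing1 hF hH).apply_eq (hUe hx) hxB).symm
  · rw [hC_apply, hc.coeff_two_eq hgen hext]
    exact (((hK.pairing2_coordinates hF hH).const_mul _).apply_eq (hUe hx) hxB).symm
  · rw [hC_apply, hc.coeff_two_eq hgen hext]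
    exact (((hK.pairing2 hF hH).const_mul _).apply_eq (hUe hx) hxB).symm
  · rw [hC_apply, hc.coeff_three_eq hgen hext]
    exact ((((hK.pairing3 hF hH).const_mul _).add
      ((hK.curvaturePairing hF hH).const_mul _)).apply_eq (hUe hx) hxB).symm
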